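/- **Setting.** Let $z_t=(x_t,y_t)$, $t\ge 1$, be i.i.d. samples with law $\mathcal D$ on $\mathcal X\times\mathcal Y$, and let $\mathcal F_t=\sigma(z_1,\dots,z_t)$ ($\mathcal F_0$ trivial). A (deterministic) online learning algorithm produces, for each $t\ge1$, a function $f_t:\mathcal X\to\mathcal Y$ from $z_1,\dots,z_{t-1}$. Let $\ell:\mathcal Y\times\mathcal Y\to[0,\infty)$ be a loss and $\ell_t(x,y)=\ell(f_t(x),y)$. Expectations and variances $\mathbb E[\ell_t(Z)\mid\mathcal F_{t-1}]$, $\operatorname{Var}(\ell_t\mid\mathcal F_{t-1})$, $\operatorname{Var}(\ell_t(Z)-\ell_{t-1}(Z)\mid\mathcal F_{t-1})$ are taken over a fresh sample $Z\sim\mathcal D$ with $z_1,\dots,z_{t-1}$ held fixed. Let $(\gamma_t)_{t\ge2}\subset[0,1]$ be deterministic weights and define the OEUVRE estimator by $$L_1=\ell_1(z_1),\qquad L_t=\ell_t(z_t)+(1-\gamma_t)\bigl[L_{t-1}-\ell_{t-1}(z_t)\bigr]\quad(t\ge2),$$ and $M_t=L_t-\mathbb E[\ell_t(Z)\mid\mathcal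 F_{t-1}]$. Let $(\sigma_t)_{t\ge2}$ be a deterministic nonnegative sequence with $\operatorname{Var}(\ell_t(Z)-\ell_{t-1}(Z)\mid\mathcal F_{t-1})\le\sigma_t^2$ almost surely for all $t\ge 2$. **Theorem.** Let $\nu,b>0$ and let $v^*$ be a random variable with values in $[\nu^2,b^2]$. Assume: 1. $\operatorname{Var}(\ell_t\mid\mathcal F_{t-1})\in[\nu^2,b^2]$ almost surely for every $t\ge1$; 2. $\operatorname{Var}(\ell_t\mid\mathcal F_{t-1})\to v^*$ in probability; 3. the increments $\xi_t=M_t-(1-\gamma_t)M_{t-1}$, i.e. the updates $\ell_t(z_t)-(1-\gamma_t)\ell_{t-1}(z_t)$ centred at their conditional expectations given $\mathcal F_{t-1}$, have finite fourth moments and bounded (total) kurtosis: there is $\kappa$ such that $\mathbb E[(\xi_t-\mathbb E\xi_t)^4]/\operatorname{Var}(\xi_t)^2\le\kappa$ for all $t\ge2$; 4. $\gamma_t\to0$ and $\gamma_{t}/\gamma_{t-1}\to1$ as $t\to\infty$; for all large $t$, $\gamma_t>0$ and $1/\gamma_t-1/\gamma_{t-1}\le1$; and $\gamma_t=\omega(\sigma_t)$,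 i.e. $\sigma_t=o(\gamma_t)$. (For example $\gamma_t=1/t$ when $\sigma_t=o(1/t)$.) Then $$\frac{M_t}{\sqrt{V_t}}\ \xrightarrow{\ d\ }\ \mathcal N(0,1),\qquad V_t=\sum_{i=1}^t\Bigl(\prod_{j=i+1}^t(1-\gamma_j)\Bigr)^2\operatorname{Var}(M_i\mid\mathcal F_{i-1}).$$ When all $\gamma_j<1$ and $\Gamma_t=\prod_{j=2}^t(1-\gamma_j)$, one has $V_t=\Gamma_t^2\sum_{i=1}^t\operatorname{Var}(M_i/\Gamma_i\mid\mathcal F_{i-1})$. -/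

import Mathlib

open MeasureTheory ProbabilityTheory Filter Topology Asymptotics

noncomputable section

namespace Oeuvre

variable {Ω 𝒳 𝒴 : Type*} [MeasurableSpace 𝒳] [MeasurableSpace 𝒴]

/-- The canonical filtration `F_t = σ(z_1, …, z_t)` of the sample sequence; `F_0` is trivial. -/
@[reducible] def sampleSigma (z : ℕ → Ω → 𝒳 × 𝒴) (t : ℕ) : MeasurableSpace Ω :=
  ⨆ s ∈ Finset.Icc 1 t, MeasurableSpace.comap (z s) inferInstance

/-- The function `f_t : 𝒳 → 𝒴` learned from the first `t - 1` samples `z_1, …, z_{t-1}` (`t ≥ 1`).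
An online learning algorithm `A` maps a finite sequence of `n` samples to a function. -/
def learned (A : (n : ℕ) → (Fin n → 𝒳 × 𝒴) → 𝒳 → 𝒴) (z : ℕ → Ω → 𝒳 × 𝒴)
    (t : ℕ) (ω : Ω) : 𝒳 → 𝒴 :=
  A (t - 1) (fun s : Fin (t - 1) => z (s + 1) ω)

/-- `ℓ_t(x, y) = ℓ(f_t(x), y)`. -/
def lossAt (ℓ : 𝒴 → 𝒴 → ℝ) (A : (n : ℕ) → (Fin n → 𝒳 × 𝒴) → 𝒳 → 𝒴)
    (z : ℕ → Ω → 𝒳 × 𝒴) (t : ℕ) (ω : Ω) (w : 𝒳 × 𝒴) : ℝ :=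
  ℓ (learned A z t ω w.1) w.2

/-- The expected loss `E[ℓ_t(Z) | F_{t-1}] = E_{Z ∼ D}[ℓ_t(Z)]`: the samples `z_1, …, z_{t-1}` are
held fixed and the expectation is over a fresh sample `Z ∼ D`. -/
def expectedLoss (ℓ : 𝒴 → 𝒴 → ℝ) (A : (n : ℕ) → (Fin n → 𝒳 × 𝒴) → 𝒳 → 𝒴)
    (z : ℕ → Ω → 𝒳 × 𝒴) (D : Measure (𝒳 × 𝒴)) (t : ℕ) (ω : Ω) : ℝ :=
  ∫ w, lossAt ℓ A z t ω w ∂D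

/-- The conditional variance `Var(ℓ_t | F_{t-1})`: the variance of `ℓ_t(Z)`, `Z ∼ D`, with the
samples `z_1, …, z_{t-1}` held fixed. -/
def lossVar (ℓ : 𝒴 → 𝒴 → ℝ) (A : (n : ℕ) → (Fin n → 𝒳 × 𝒴) → 𝒳 → 𝒴)
    (z : ℕ → Ω → 𝒳 × 𝒴) (D : Measure (𝒳 × 𝒴)) (t : ℕ) (ω : Ω) : ℝ :=
  Var[fun w => lossAt ℓ A z t ω w; D]

/-- The conditional variance `Var(ℓ_t(Z) - ℓ_{t-1}(Z) | F_{t-1})`. -/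
def lossDiffVar (ℓ : 𝒴 → 𝒴 → ℝ) (A : (n : ℕ) → (Fin n → 𝒳 × 𝒴) → 𝒳 → 𝒴)
    (z : ℕ → Ω → 𝒳 × 𝒴) (D : Measure (𝒳 × 𝒴)) (t : ℕ) (ω : Ω) : ℝ :=
  Var[fun w => lossAt ℓ A z t ω w - lossAt ℓ A z (t - 1) ω w; D]

/-- The OEUVRE estimator: `L_1 = ℓ_1(z_1)` and
`L_t = ℓ_t(z_t) + (1 - γ_t) (L_{t-1} - ℓ_{t-1}(z_t))` for `t ≥ 2`. The value at `t = 0` is unused. -/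
def estimator (ℓ : 𝒴 → 𝒴 → ℝ) (A : (n : ℕ) → (Fin n → 𝒳 × 𝒴) → 𝒳 → 𝒴)
    (z : ℕ → Ω → 𝒳 × 𝒴) (γ : ℕ → ℝ) : ℕ → Ω → ℝ
  | 0, _ => 0
  | 1, ω => lossAt ℓ A z 1 ω (z 1 ω)
  | t + 2, ω => lossAt ℓ A z (t + 2) ω (z (t + 2) ω)
      + (1 - γ (t + 2)) * (estimator ℓ A z γ (t + 1) ω - lossAt ℓ A z (t + 1) ω (z (t + 2) ω))

/-- `M_t = L_t - E[ℓ_t(Z) | F_{t-1}]`. -/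
def centered (ℓ : 𝒴 → 𝒴 → ℝ) (A : (n : ℕ) → (Fin n → 𝒳 × 𝒴) → 𝒳 → 𝒴)
    (z : ℕ → Ω → 𝒳 × 𝒴) (D : Measure (𝒳 × 𝒴)) (γ : ℕ → ℝ) (t : ℕ) (ω : Ω) : ℝ :=
  estimator ℓ A z γ t ω - expectedLoss ℓ A z D t ω

/-- The loss update `ℓ_t(z_t) - (1 - γ_t) ℓ_{t-1}(z_t)`, centred at its conditional expectation
given `F_{t-1}`. It equals `M_t - (1 - γ_t) M_{t-1}` for `t ≥ 2`. -/
def increment (ℓ : 𝒴 → 𝒴 → ℝ) (A : (n : ℕ) → (Fin n → 𝒳 × 𝒴) → 𝒳 → 𝒴)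
    (z : ℕ → Ω → 𝒳 × 𝒴) (D : Measure (𝒳 × 𝒴)) (γ : ℕ → ℝ) (t : ℕ) (ω : Ω) : ℝ :=
  (lossAt ℓ A z t ω (z t ω) - (1 - γ t) * lossAt ℓ A z (t - 1) ω (z t ω))
    - (expectedLoss ℓ A z D t ω - (1 - γ t) * expectedLoss ℓ A z D (t - 1) ω)

/-- The sum of conditional variances of the `M_i`, on the scale of `M_t`:
`V_t = ∑_{i=1}^t (∏_{j=i+1}^t (1 - γ_j))² Var(M_i | F_{i-1})`. With `Γ_t = ∏_{j=2}^t (1 - γ_j)` and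
`Γ_t ≠ 0` this is `Γ_t² ∑_{i=1}^t Var(M_i / Γ_i | F_{i-1})`, that is, `Γ_t²` times the sum of the
conditional variances of the martingale `M_i / Γ_i`. -/
def condVarSum [MeasurableSpace Ω] (μ : Measure Ω)
    (ℓ : 𝒴 → 𝒴 → ℝ) (A : (n : ℕ) → (Fin n → 𝒳 × 𝒴) → 𝒳 → 𝒴)
    (z : ℕ → Ω → 𝒳 × 𝒴) (D : Measure (𝒳 × 𝒴)) (γ : ℕ → ℝ) (t : ℕ) (ω : Ω) : ℝ :=
  ∑ i ∈ Finset.Icc 1 t, (∏ j ∈ Finset.Icc (i + 1) t, (1 - γ j)) ^ 2 *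
    (Var[centered ℓ A z D γ i; μ | sampleSigma z (i - 1)]) ω

/-- The kurtosis `E[(X - E X)⁴] / Var(X)²`. -/
def kurtosis [MeasurableSpace Ω] (X : Ω → ℝ) (μ : Measure Ω) : ℝ :=
  centralMoment X 4 μ / Var[X; μ] ^ 2

end Oeuvre

end

/-!
The centred estimator satisfies `M_t = (1 - γ_t) M_{t-1} + ξ_t`, where the increment `ξ_t` is a
function of the past samples and of the new one whose mean over the new sample vanishes. Hence,
from a time on after which `0 < γ_t < 1`, dividing `M_t` by `∏ (1 - γ_j)` gives a martingale, and
`M_t / √V_t` is that martingale divided by the root of the sum of its conditional variances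
(`centered_eq_prod_mul`, `condVarSum_eq_prod_sq_mul`).

The conditional variance of `ξ_t` is the variance of `(ℓ_t - ℓ_{t-1}) + γ_t ℓ_{t-1}` over a fresh
sample, so by the triangle inequality its root is `γ_t` times the standard deviation of `ℓ_{t-1}`,
up to `σ_t = o(γ_t)` (`abs_sqrt_updateVar_sub_le`). Thus the increments of the rescaled martingale are
`r_k ρ_k η_k`, with deterministic `r_k` (`weight`), predictable `ρ_k` bounded away from zero and
infinity and converging in probability to `√v*`, and `η_k` a normalized martingale difference
sequence, whose fourth moments are bounded because the kurtosis of the increments is. The condition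
`1 / γ_t - 1 / γ_{t-1} ≤ 1` says that `r_k` does not decrease, so that `∑ r_k²` diverges; together
with `γ_t / γ_{t-1} → 1` and `γ_t → 0` it makes each `r_k²` negligible with respect to the sum
(`eventually_weight_sq_le`).

What remains is a self-normalized martingale central limit theorem
(`IsNormalizedMartingaleDiff.tendstoInDistribution_selfNormalized`). Put `R_n = ∑_{k<n} r_k²`. As
the `η_k` have conditional variance one, the characteristic function of `∑ r_k η_k / √R_n` can be
compared with the Gaussian one factor by factor, and Lévy's theorem gives convergence to `N(0, 1)`
(`IsNormalizedMartingaleDiff.tendstoInDistribution_sum`). The normalized sum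
`∑ r_k ρ_k η_k / √R_n` differs from `√v*` times this one by an amount vanishing in `L¹`: although
`√v*` is not adapted, it is close to `ρ_m` for `m` large, and the increments after time `m` are
orthogonal (`IsNormalizedMartingaleDiff.tendsto_integral_abs_sum_sub`). The conditional variances
satisfy `∑ r_k² ρ_k² / R_n → v*` by averaging, so the factors `√v*` cancel in the quotient and
Slutsky's theorem concludes.
-/

namespace Oeuvre

/-! ### Elementary estimates -/

/-- Second-order Taylor bound for the characters of `ℝ`, valid on the whole line. -/
lemma norm_cexp_mul_I_sub_taylor_le (x : ℝ) :
    ‖Complex.exp (x * Complex.I) - (1 + x * Complex.I - (x : ℂ) ^ 2 / 2)‖ ≤ 4 * |x| ^ 3 := by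
  rcases le_total |x| 1 with h | h
  · have h1 := Complex.norm_exp_sub_sum_le_norm_mul_exp ((x : ℂ) * Complex.I) 3
    have h2 : ‖(x : ℂ) * Complex.I‖ = |x| := by simp
    have h3 : ∑ m ∈ Finset.range 3, ((x : ℂ) * Complex.I) ^ m / (m.factorial : ℂ)
        = 1 + x * Complex.I - (x : ℂ) ^ 2 / 2 := by
      simp [Finset.sum_range_succ, mul_pow, Nat.factorial]
      ring
    rw [h2, h3] at h1
    refine h1.trans ?_
    have h4 : Real.exp |x| ≤ 4 := by
      calc Real.exp |x| ≤ Real.exp 1 := Real.exp_le_exp.2 h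
        _ ≤ 4 := by linarith [Real.exp_one_lt_d9]
    nlinarith [pow_nonneg (abs_nonneg x) 3]
  · have h1 : ‖Complex.exp (x * Complex.I)‖ = 1 := Complex.norm_exp_ofReal_mul_I x
    have h2 : ‖(1 : ℂ) + x * Complex.I - (x : ℂ) ^ 2 / 2‖ ≤ 1 + |x| + |x| ^ 2 / 2 := by
      refine (norm_sub_le _ _).trans ?_
      refine add_le_add ((norm_add_le _ _).trans ?_) ?_ <;> simp
    refine (norm_sub_le _ _).trans ?_
    rw [h1]
    have h5 : |x| ≤ |x| ^ 3 := le_self_pow₀ h (by norm_num)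
    have h6 : |x| ^ 2 ≤ |x| ^ 3 := pow_le_pow_right₀ h (by norm_num)
    linarith

lemma abs_one_sub_sub_exp_neg_le {u : ℝ} (hu : 0 ≤ u) : |1 - u - Real.exp (-u)| ≤ u ^ 2 := by
  rcases le_total u 1 with h | h
  · have h1 := Real.norm_exp_sub_one_sub_id_le (x := -u) (by simpa [abs_of_nonneg hu] using h)
    rw [Real.norm_eq_abs, Real.norm_eq_abs, abs_neg, abs_of_nonneg hu] at h1
    rwa [show 1 - u - Real.exp (-u) = -(Real.exp (-u) - 1 - -u) by ring, abs_neg]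
  · rw [abs_le]
    constructor <;> nlinarith [Real.exp_pos (-u), Real.exp_le_one_iff.2 (neg_nonpos.2 hu)]

lemma abs_pow_three_le (x : ℝ) : |x| ^ 3 ≤ 1 + x ^ 4 := by
  have : x ^ 4 = |x| ^ 4 := (Even.pow_abs (by decide) x).symm
  rw [this]
  rcases le_total |x| 1 with h | h
  · have := pow_le_one₀ (n := 3) (abs_nonneg x) h
    have := pow_nonneg (abs_nonneg x) 4
    linarith
  · have := pow_le_pow_right₀ h (show 3 ≤ 4 by norm_num)
    linarith

section Prob

variable {Ω : Type*} {mΩ : MeasurableSpace Ω} {μ : Measure Ω}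

/-! ### Convergence in probability, second moments and conditioning -/

/-- Continuous mapping theorem for convergence in probability of two sequences. -/
lemma tendstoInMeasure_comp₂ [IsFiniteMeasure μ] {X Y : ℕ → Ω → ℝ} {x y : Ω → ℝ}
    (hX : TendstoInMeasure μ X atTop x) (hY : TendstoInMeasure μ Y atTop y) {f : ℝ × ℝ → ℝ}
    (hf : ∀ᵐ ω ∂μ, ContinuousAt f (x ω, y ω))
    (hfm : ∀ n, AEStronglyMeasurable (fun ω => f (X n ω, Y n ω)) μ) :
    TendstoInMeasure μ (fun n ω => f (X n ω, Y n ω)) atTop (fun ω => f (x ω, y ω)) := by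
  rw [exists_seq_tendstoInMeasure_atTop_iff hfm]
  intro ns hns
  obtain ⟨n1, hn1, h1⟩ := (hX.comp hns.tendsto_atTop).exists_seq_tendsto_ae
  obtain ⟨n2, hn2, h2⟩ :=
    (hY.comp (hns.tendsto_atTop.comp hn1.tendsto_atTop)).exists_seq_tendsto_ae
  refine ⟨n1 ∘ n2, hn1.comp hn2, ?_⟩
  filter_upwards [h1, h2, hf] with ω h3 h4 h5
  exact h5.tendsto.comp ((h3.comp hn2.tendsto_atTop).prodMk_nhds h4)

/-- Bounded convergence theorem for convergence in probability. -/
lemma tendsto_integral_abs_sub_of_tendstoInMeasure [IsFiniteMeasure μ] {X : ℕ → Ω → ℝ}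
    {x : Ω → ℝ} {C : ℝ} (hX : TendstoInMeasure μ X atTop x)
    (hXm : ∀ n, AEStronglyMeasurable (X n) μ) (hxm : AEStronglyMeasurable x μ)
    (hb : ∀ n, ∀ᵐ ω ∂μ, |X n ω - x ω| ≤ C) :
    Tendsto (fun n => ∫ ω, |X n ω - x ω| ∂μ) atTop (𝓝 0) := by
  refine tendsto_of_subseq_tendsto fun ns hns => ?_
  obtain ⟨n1, hn1, h1⟩ := (hX.comp hns).exists_seq_tendsto_ae
  refine ⟨n1, ?_⟩
  have := tendsto_integral_of_dominated_convergence (μ := μ)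
    (F := fun n ω => |X (ns (n1 n)) ω - x ω|) (f := fun _ => 0) (fun _ => C)
    (fun n => ((hXm _).sub hxm).norm) (integrable_const C)
    (fun n => by simpa using hb _) ?_
  · simpa using this
  · filter_upwards [h1] with ω h2
    have := (h2.sub_const (x ω)).abs
    simpa using this

lemma tendstoInMeasure_zero_of_tendsto_integral_abs [IsFiniteMeasure μ] {X : ℕ → Ω → ℝ}
    (hX : ∀ n, Integrable (X n) μ) (h : Tendsto (fun n => ∫ ω, |X n ω| ∂μ) atTop (𝓝 0)) :
    TendstoInMeasure μ X atTop (fun _ => 0) := by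
  refine tendstoInMeasure_of_tendsto_eLpNorm (p := 1) one_ne_zero
    (fun n => (hX n).aestronglyMeasurable) aestronglyMeasurable_const ?_
  have : ∀ n, eLpNorm (X n - fun _ => (0 : ℝ)) 1 μ = ENNReal.ofReal (∫ ω, |X n ω| ∂μ) := fun n => by
    have e : (X n - fun _ => (0 : ℝ)) = X n := by ext; simp
    rw [e, eLpNorm_one_eq_lintegral_enorm,
      ← ofReal_integral_norm_eq_lintegral_enorm (hX n)]
    rfl
  simp_rw [this]
  simpa using ENNReal.tendsto_ofReal h

lemma integral_abs_mul_le_sqrt {f g : Ω → ℝ} (hf : MemLp f 2 μ) (hg : MemLp g 2 μ) :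
    ∫ ω, |f ω * g ω| ∂μ ≤ √(∫ ω, f ω ^ 2 ∂μ) * √(∫ ω, g ω ^ 2 ∂μ) := by
  have := integral_mul_le_Lp_mul_Lq_of_nonneg (μ := μ) (p := 2) (q := 2)
    Real.HolderConjugate.two_two
    (f := fun ω => |f ω|) (g := fun ω => |g ω|) (ae_of_all _ fun _ => abs_nonneg _)
    (ae_of_all _ fun _ => abs_nonneg _) (by simpa using hf.norm) (by simpa using hg.norm)
  simpa [abs_mul, Real.sqrt_eq_rpow] using this

lemma integral_abs_le_sqrt [IsProbabilityMeasure μ] {f : Ω → ℝ} (hf : MemLp f 2 μ) :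
    ∫ ω, |f ω| ∂μ ≤ √(∫ ω, f ω ^ 2 ∂μ) := by
  simpa using integral_abs_mul_le_sqrt hf (memLp_const (1 : ℝ))

lemma tendstoInDistribution_of_shift {Ω Ω' : Type*} [MeasurableSpace Ω] [MeasurableSpace Ω']
    {μ : Measure Ω} [IsProbabilityMeasure μ] {μ' : Measure Ω'} [IsProbabilityMeasure μ']
    {X : ℕ → Ω → ℝ} {Z : Ω' → ℝ} (hX : ∀ n, AEMeasurable (X n) μ) (m : ℕ)
    (h : TendstoInDistribution (fun n => X (n + m)) atTop Z (fun _ => μ) μ') :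
    TendstoInDistribution X atTop Z (fun _ => μ) μ' where
  forall_aemeasurable := hX
  aemeasurable_limit := h.aemeasurable_limit
  tendsto := (tendsto_add_atTop_iff_nat m).1 h.tendsto

lemma memLp_two_of_variance_pos [IsFiniteMeasure μ] {X : Ω → ℝ} (hX : AEStronglyMeasurable X μ)
    (h : 0 < Var[X; μ]) : MemLp X 2 μ := by
  by_contra hn
  rw [variance_of_not_memLp hX hn] at h
  exact lt_irrefl _ h

/-- Triangle inequality for standard deviations. -/
lemma sqrt_variance_add_le [IsProbabilityMeasure μ] {X Y : Ω → ℝ} (hX : MemLp X 2 μ)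
    (hY : MemLp Y 2 μ) :
    √(Var[fun ω => X ω + Y ω; μ]) ≤ √(Var[X; μ]) + √(Var[Y; μ]) := by
  have hF : MemLp (fun ω => X ω - ∫ ω, X ω ∂μ) 2 μ := hX.sub (memLp_const _)
  have hG : MemLp (fun ω => Y ω - ∫ ω, Y ω ∂μ) 2 μ := hY.sub (memLp_const _)
  have iX := hX.integrable (by norm_num)
  have iY := hY.integrable (by norm_num)
  rw [variance_eq_integral (X := fun ω => X ω + Y ω)
      (hX.add hY).aestronglyMeasurable.aemeasurable,
    variance_eq_integral hX.aestronglyMeasurable.aemeasurable,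
    variance_eq_integral hY.aestronglyMeasurable.aemeasurable, integral_add iX iY]
  refine Real.sqrt_le_iff.2 ⟨by positivity, ?_⟩
  rw [add_sq, Real.sq_sqrt (integral_nonneg fun _ => sq_nonneg _),
    Real.sq_sqrt (integral_nonneg fun _ => sq_nonneg _)]
  have h1 := integral_abs_mul_le_sqrt hF hG
  have h2 := (le_abs_self _).trans ((abs_integral_le_integral_abs (μ := μ)
    (f := fun ω => (X ω - ∫ ω, X ω ∂μ) * (Y ω - ∫ ω, Y ω ∂μ))).trans h1)
  have iFG : Integrable (fun ω => 2 * ((X ω - ∫ ω, X ω ∂μ) * (Y ω - ∫ ω, Y ω ∂μ))) μ :=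
    (hF.integrable_mul hG).const_mul 2
  have e : ∀ ω, (X ω + Y ω - (∫ ω, X ω ∂μ + ∫ ω, Y ω ∂μ)) ^ 2
      = (X ω - ∫ ω, X ω ∂μ) ^ 2 + 2 * ((X ω - ∫ ω, X ω ∂μ) * (Y ω - ∫ ω, Y ω ∂μ))
        + (Y ω - ∫ ω, Y ω ∂μ) ^ 2 := fun ω => by ring
  simp_rw [e]
  rw [integral_add (by exact hF.integrable_sq.add iFG) hG.integrable_sq,
    integral_add hF.integrable_sq iFG, integral_const_mul]
  linarith

lemma abs_sqrt_variance_add_sub_le [IsProbabilityMeasure μ] {X Y : Ω → ℝ} (hX : MemLp X 2 μ)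
    (hY : MemLp Y 2 μ) :
    |√(Var[fun ω => X ω + Y ω; μ]) - √(Var[Y; μ])| ≤ √(Var[X; μ]) := by
  have h1 := sqrt_variance_add_le hX hY
  have h2 := sqrt_variance_add_le hX.neg (hX.add hY)
  have e : (fun ω => (-X) ω + (X + Y) ω) = Y := by ext ω; simp
  rw [e, variance_neg] at h2
  change √(Var[Y; μ]) ≤ √(Var[X; μ]) + √(Var[fun ω => X ω + Y ω; μ]) at h2
  rw [abs_le]
  constructor <;> linarith

/-- Conditioning on one of two independent variables amounts to integrating out the other. -/
lemma condExp_comap_of_indepFun [IsProbabilityMeasure μ] {S T : Type*} [MeasurableSpace S]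
    [MeasurableSpace T] {Y : Ω → S} {Z : Ω → T} (hY : Measurable Y) (hZ : Measurable Z)
    (h : IndepFun Y Z μ) {f : S × T → ℝ} (hf : Measurable f)
    (hi : Integrable (fun ω => f (Y ω, Z ω)) μ) :
    μ[fun ω => f (Y ω, Z ω) | MeasurableSpace.comap Y inferInstance]
      =ᵐ[μ] fun ω => ∫ t, f (Y ω, t) ∂(μ.map Z) := by
  have hYZ : Measurable fun ω => (Y ω, Z ω) := hY.prodMk hZ
  have hlaw : μ.map (fun ω => (Y ω, Z ω)) = (μ.map Y).prod (μ.map Z) :=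
    (indepFun_iff_map_prod_eq_prod_map_map hY.aemeasurable hZ.aemeasurable).1 h
  have : IsProbabilityMeasure (μ.map Y) := Measure.isProbabilityMeasure_map hY.aemeasurable
  have : IsProbabilityMeasure (μ.map Z) := Measure.isProbabilityMeasure_map hZ.aemeasurable
  have hfi : Integrable f ((μ.map Y).prod (μ.map Z)) := by
    rw [← hlaw]
    exact (integrable_map_measure hf.aestronglyMeasurable hYZ.aemeasurable).2 hi
  have hGm : StronglyMeasurable fun y => ∫ t, f (y, t) ∂(μ.map Z) :=
    hf.stronglyMeasurable.integral_prod_right'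
  have hGi : Integrable (fun ω => ∫ t, f (Y ω, t) ∂(μ.map Z)) μ :=
    (integrable_map_measure hGm.aestronglyMeasurable hY.aemeasurable).1 hfi.integral_prod_left
  refine (ae_eq_condExp_of_forall_setIntegral_eq hY.comap_le hi (fun s _ _ => hGi.integrableOn)
    ?_ ?_).symm
  · rintro s ⟨B, hB, rfl⟩ -
    have e1 : ∫ ω in Y ⁻¹' B, (∫ t, f (Y ω, t) ∂(μ.map Z)) ∂μ
        = ∫ y in B, (∫ t, f (y, t) ∂(μ.map Z)) ∂(μ.map Y) :=
      (setIntegral_map hB hGm.aestronglyMeasurable hY.aemeasurable).symm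
    have e2 : ∫ ω in Y ⁻¹' B, f (Y ω, Z ω) ∂μ
        = ∫ p in B ×ˢ Set.univ, f p ∂((μ.map Y).prod (μ.map Z)) := by
      rw [← hlaw, setIntegral_map (hB.prod MeasurableSet.univ) hf.aestronglyMeasurable
        hYZ.aemeasurable]
      congr 2
      ext ω; simp
    rw [e1, e2, setIntegral_prod f hfi.integrableOn]
    simp
  · exact (hGm.comp_measurable (comap_measurable Y)).aestronglyMeasurable

lemma integral_smul_of_condExp_eq {E : Type*} [NormedAddCommGroup E] [NormedSpace ℝ E]
    [CompleteSpace E] [IsFiniteMeasure μ] {m : MeasurableSpace Ω} (hm : m ≤ mΩ)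
    {f h : Ω → ℝ} {g : Ω → E} (hg : AEStronglyMeasurable[m] g μ)
    (hfg : Integrable (f • g) μ) (hf : Integrable f μ) (hfh : μ[f | m] =ᵐ[μ] h) :
    ∫ ω, f ω • g ω ∂μ = ∫ ω, h ω • g ω ∂μ := by
  have h1 := condExp_smul_of_aestronglyMeasurable_right hf hfg hg
  calc ∫ ω, f ω • g ω ∂μ = ∫ ω, (μ[f • g | m]) ω ∂μ := (integral_condExp hm).symm
    _ = ∫ ω, h ω • g ω ∂μ := by
      refine integral_congr_ae ?_
      filter_upwards [h1, hfh] with ω h2 h3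
      rw [h2, Pi.smul_apply', h3]

/-! ### Normalized martingale difference sequences -/

/-- A sequence of random variables, `η k` being revealed at time `k + 1` of the filtration, which
given the past `ℱ k` are centred with variance one, and whose fourth moments are bounded by `K`. -/
structure IsNormalizedMartingaleDiff (ℱ : Filtration ℕ mΩ) (η : ℕ → Ω → ℝ) (μ : Measure Ω)
    (K : ℝ) : Prop where
  stronglyMeasurable : ∀ k, StronglyMeasurable[ℱ (k + 1)] (η k)
  memLp : ∀ k, MemLp (η k) 4 μ
  condExp_eq : ∀ k, μ[η k | ℱ k] =ᵐ[μ] fun _ => 0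
  condExp_sq : ∀ k, μ[fun ω => η k ω ^ 2 | ℱ k] =ᵐ[μ] fun _ => 1
  moment_four_le : ∀ k, ∫ ω, η k ω ^ 4 ∂μ ≤ K

lemma _root_.MeasureTheory.MemLp.integrable_pow_four {X : Ω → ℝ} (hX : MemLp X 4 μ) :
    Integrable (fun ω => X ω ^ 4) μ := by
  have := hX.integrable_norm_pow (p := 4) (by norm_num)
  refine this.congr (ae_of_all _ fun ω => ?_)
  simp only [Real.norm_eq_abs]
  exact Even.pow_abs (by decide) _

/-- One step of the characteristic function estimate: given the past, a centred variable of
unit variance acts on the characteristic function like a Gaussian one, up to third order. -/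
lemma norm_integral_mul_cexp_sub_le {m mΩ : MeasurableSpace Ω} {μ : Measure Ω}
    [IsProbabilityMeasure μ] (hm : m ≤ mΩ)
    {X : Ω → ℝ} {Z : Ω → ℂ} {K : ℝ}
    (hX : MemLp X 4 μ) (h1 : μ[X | m] =ᵐ[μ] fun _ => 0)
    (h2 : μ[fun ω => X ω ^ 2 | m] =ᵐ[μ] fun _ => 1) (h4 : ∫ ω, X ω ^ 4 ∂μ ≤ K)
    (hZ : AEStronglyMeasurable[m] Z μ) (hZ1 : ∀ ω, ‖Z ω‖ ≤ 1) (x : ℝ) :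
    ‖∫ ω, Z ω * Complex.exp ((x * X ω : ℝ) * Complex.I) ∂μ
      - Real.exp (-(x ^ 2 / 2)) * ∫ ω, Z ω ∂μ‖ ≤ 4 * |x| ^ 3 * (1 + K) + x ^ 4 := by
  have hZ' : AEStronglyMeasurable Z μ := AEStronglyMeasurable.mono hm hZ
  have hZb : ∀ᵐ ω ∂μ, ‖Z ω‖ ≤ 1 := ae_of_all _ hZ1
  have hX1 : Integrable X μ := hX.integrable (by norm_num)
  have hX2 : Integrable (fun ω => X ω ^ 2) μ :=
    (hX.mono_exponent (show (2 : ENNReal) ≤ 4 by norm_num)).integrable_sq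
  have hX4 := hX.integrable_pow_four
  have hZi : Integrable Z μ := Integrable.of_bound hZ' 1 hZb
  have i1 : Integrable (fun ω => X ω • Z ω) μ := hX1.smul_bdd 1 hZ' hZb
  have i2 : Integrable (fun ω => X ω ^ 2 • Z ω) μ := hX2.smul_bdd 1 hZ' hZb
  have e1 : ∫ ω, X ω • Z ω ∂μ = 0 := by
    rw [integral_smul_of_condExp_eq hm hZ i1 hX1 h1]; simp
  have e2 : ∫ ω, X ω ^ 2 • Z ω ∂μ = ∫ ω, Z ω ∂μ := by
    have := integral_smul_of_condExp_eq hm (f := fun ω => X ω ^ 2) hZ i2 hX2 h2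
    simpa using this
  set r : Ω → ℂ := fun ω => Complex.exp ((x * X ω : ℝ) * Complex.I)
    - (1 + (x * X ω : ℝ) * Complex.I - ((x * X ω : ℝ) : ℂ) ^ 2 / 2) with hr
  have hrb : ∀ ω, ‖Z ω * r ω‖ ≤ 4 * |x| ^ 3 * (1 + X ω ^ 4) := fun ω => by
    have := norm_cexp_mul_I_sub_taylor_le (x * X ω)
    have h3 := abs_pow_three_le (X ω)
    calc ‖Z ω * r ω‖ = ‖Z ω‖ * ‖r ω‖ := norm_mul _ _
      _ ≤ 1 * (4 * |x * X ω| ^ 3) := mul_le_mul (hZ1 ω) this (norm_nonneg _) zero_le_one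
      _ = 4 * |x| ^ 3 * |X ω| ^ 3 := by rw [abs_mul, mul_pow]; ring
      _ ≤ _ := by gcongr
  have hXm : AEMeasurable X μ := hX.aestronglyMeasurable.aemeasurable
  have hrm : AEStronglyMeasurable (fun ω => Z ω * r ω) μ := by
    refine hZ'.mul (AEMeasurable.aestronglyMeasurable ?_)
    simp only [hr]
    fun_prop
  have hbi : Integrable (fun ω => 4 * |x| ^ 3 * (1 + X ω ^ 4)) μ :=
    ((integrable_const _).add hX4).const_mul _
  have ir : Integrable (fun ω => Z ω * r ω) μ := hbi.mono' hrm (ae_of_all _ hrb)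
  have key : ∫ ω, Z ω * Complex.exp ((x * X ω : ℝ) * Complex.I) ∂μ
      = (1 - (x : ℂ) ^ 2 / 2) * ∫ ω, Z ω ∂μ + ∫ ω, Z ω * r ω ∂μ := by
    have : ∀ ω, Z ω * Complex.exp ((x * X ω : ℝ) * Complex.I)
        = Z ω + (x * Complex.I) * (X ω • Z ω) - ((x : ℂ) ^ 2 / 2) * (X ω ^ 2 • Z ω)
          + Z ω * r ω := fun ω => by
      simp only [hr, Complex.real_smul]
      push_cast
      ring
    simp_rw [this]
    have j1 : Integrable (fun ω => (x * Complex.I) * (X ω • Z ω)) μ := i1.const_mul _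
    have j2 : Integrable (fun ω => ((x : ℂ) ^ 2 / 2) * (X ω ^ 2 • Z ω)) μ := i2.const_mul _
    rw [integral_add (by exact (hZi.add j1).sub j2) ir, integral_sub (by exact hZi.add j1) j2,
      integral_add hZi j1, integral_const_mul, integral_const_mul, e1, e2]
    ring
  have hK : ‖∫ ω, Z ω * r ω ∂μ‖ ≤ 4 * |x| ^ 3 * (1 + K) := by
    refine (norm_integral_le_of_norm_le hbi (ae_of_all _ hrb)).trans ?_
    rw [integral_const_mul, integral_add (integrable_const _) hX4]
    simp only [integral_const, probReal_univ, smul_eq_mul, one_mul]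
    gcongr
  have hZn : ‖∫ ω, Z ω ∂μ‖ ≤ 1 := by
    refine (norm_integral_le_of_norm_le (integrable_const (1 : ℝ)) hZb).trans (by simp)
  have hexp := abs_one_sub_sub_exp_neg_le (u := x ^ 2 / 2) (by positivity)
  rw [key]
  calc ‖(1 - (x : ℂ) ^ 2 / 2) * ∫ ω, Z ω ∂μ + ∫ ω, Z ω * r ω ∂μ
        - Real.exp (-(x ^ 2 / 2)) * ∫ ω, Z ω ∂μ‖
      = ‖∫ ω, Z ω * r ω ∂μ
        + ((1 - x ^ 2 / 2 - Real.exp (-(x ^ 2 / 2)) : ℝ) : ℂ) * ∫ ω, Z ω ∂μ‖ := by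
        push_cast; ring_nf
    _ ≤ 4 * |x| ^ 3 * (1 + K) + |1 - x ^ 2 / 2 - Real.exp (-(x ^ 2 / 2))| * 1 := by
        refine (norm_add_le _ _).trans (add_le_add hK ?_)
        rw [norm_mul, Complex.norm_real, Real.norm_eq_abs]
        gcongr
    _ ≤ _ := by nlinarith [sq_nonneg (x ^ 2)]

namespace IsNormalizedMartingaleDiff

variable {ℱ : Filtration ℕ mΩ} {η : ℕ → Ω → ℝ} {K : ℝ}

lemma stronglyMeasurable_sum (hη : IsNormalizedMartingaleDiff ℱ η μ K) {c : ℕ → Ω → ℝ}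
    (hc : ∀ k, StronglyMeasurable[ℱ k] (c k)) (n : ℕ) :
    StronglyMeasurable[ℱ n] (fun ω => ∑ k ∈ Finset.range n, c k ω * η k ω) := by
  refine Finset.stronglyMeasurable_fun_sum _ fun k hk => ?_
  have hk := Finset.mem_range.1 hk
  exact ((hc k).mono (ℱ.mono hk.le)).mul ((hη.stronglyMeasurable k).mono (ℱ.mono hk))

/-- The characteristic function of a deterministic linear combination is close to the Gaussian
one; the error is of third order in the coefficients. -/
lemma norm_charFun_sub_le [IsProbabilityMeasure μ] (hη : IsNormalizedMartingaleDiff ℱ η μ K)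
    (w : ℕ → ℝ) (θ : ℝ) (n : ℕ) :
    ‖∫ ω, Complex.exp ((θ * ∑ k ∈ Finset.range n, w k * η k ω : ℝ) * Complex.I) ∂μ
      - Real.exp (-(θ ^ 2 * (∑ k ∈ Finset.range n, w k ^ 2) / 2))‖
      ≤ ∑ k ∈ Finset.range n, (4 * |θ * w k| ^ 3 * (1 + K) + (θ * w k) ^ 4) := by
  induction n with
  | zero => simp
  | succ n ih =>
    set S : Ω → ℝ := fun ω => ∑ k ∈ Finset.range n, w k * η k ω with hS
    have hSm : StronglyMeasurable[ℱ n] S :=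
      hη.stronglyMeasurable_sum (c := fun k _ => w k) (fun k => stronglyMeasurable_const) n
    set Z : Ω → ℂ := fun ω => Complex.exp ((θ * S ω : ℝ) * Complex.I) with hZ
    have hZm : StronglyMeasurable[ℱ n] Z := by
      have : Continuous fun s : ℝ => Complex.exp ((θ * s : ℝ) * Complex.I) := by fun_prop
      exact this.comp_stronglyMeasurable hSm
    have hZ1 : ∀ ω, ‖Z ω‖ = 1 := fun ω => Complex.norm_exp_ofReal_mul_I _
    have step := norm_integral_mul_cexp_sub_le (ℱ.le n) (hη.memLp n) (hη.condExp_eq n)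
      (hη.condExp_sq n) (hη.moment_four_le n) hZm.aestronglyMeasurable (fun ω => (hZ1 ω).le)
      (θ * w n)
    have e1 : ∀ ω, Complex.exp ((θ * ∑ k ∈ Finset.range (n + 1), w k * η k ω : ℝ) * Complex.I)
        = Z ω * Complex.exp ((θ * w n * η n ω : ℝ) * Complex.I) := fun ω => by
      rw [hZ, ← Complex.exp_add, Finset.sum_range_succ]
      congr 1
      simp only [hS]
      push_cast
      ring
    have e2 : Real.exp (-(θ ^ 2 * (∑ k ∈ Finset.range (n + 1), w k ^ 2) / 2))
        = Real.exp (-((θ * w n) ^ 2 / 2))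
          * Real.exp (-(θ ^ 2 * (∑ k ∈ Finset.range n, w k ^ 2) / 2)) := by
      rw [← Real.exp_add, Finset.sum_range_succ]
      congr 1
      ring
    simp_rw [e1]
    rw [e2, Finset.sum_range_succ]
    set a := ∫ ω, Z ω * Complex.exp ((θ * w n * η n ω : ℝ) * Complex.I) ∂μ
    set q := Real.exp (-((θ * w n) ^ 2 / 2))
    set p := Real.exp (-(θ ^ 2 * (∑ k ∈ Finset.range n, w k ^ 2) / 2))
    have hq1 : q ≤ 1 := Real.exp_le_one_iff.2 (by rw [neg_nonpos]; positivity)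
    have hq0 : 0 ≤ q := (Real.exp_pos _).le
    calc ‖a - ((q * p : ℝ) : ℂ)‖ = ‖(q : ℂ) * (∫ ω, Z ω ∂μ - p) + (a - q * ∫ ω, Z ω ∂μ)‖ := by
          push_cast; ring_nf
      _ ≤ 1 * ‖∫ ω, Z ω ∂μ - p‖ + ‖a - q * ∫ ω, Z ω ∂μ‖ := by
          refine (norm_add_le _ _).trans (add_le_add ?_ le_rfl)
          rw [norm_mul, Complex.norm_real, Real.norm_of_nonneg hq0]
          gcongr
      _ ≤ _ := by rw [one_mul]; exact add_le_add ih step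

lemma memLp_two [IsFiniteMeasure μ] (hη : IsNormalizedMartingaleDiff ℱ η μ K) (k : ℕ) :
    MemLp (η k) 2 μ :=
  (hη.memLp k).mono_exponent (by norm_num)

lemma memLp_mul [IsFiniteMeasure μ] (hη : IsNormalizedMartingaleDiff ℱ η μ K) {c : Ω → ℝ}
    {k : ℕ} (hc : AEStronglyMeasurable c μ) {b : ℝ} (hb : ∀ᵐ ω ∂μ, |c ω| ≤ b) :
    MemLp (fun ω => c ω * η k ω) 2 μ := by
  have := (hη.memLp_two k).mul (p := ⊤) (r := 2) (MemLp.of_bound hc b hb)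
  exact this

lemma memLp_sum [IsFiniteMeasure μ] (hη : IsNormalizedMartingaleDiff ℱ η μ K) {c : ℕ → Ω → ℝ}
    (hc : ∀ k, AEStronglyMeasurable (c k) μ) {b : ℕ → ℝ} (hb : ∀ k, ∀ᵐ ω ∂μ, |c k ω| ≤ b k)
    (s : Finset ℕ) : MemLp (fun ω => ∑ k ∈ s, c k ω * η k ω) 2 μ :=
  memLp_finsetSum _ fun k _ => hη.memLp_mul (hc k) (hb k)

lemma integral_sq_eq_one [IsProbabilityMeasure μ] (hη : IsNormalizedMartingaleDiff ℱ η μ K)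
    (k : ℕ) : ∫ ω, η k ω ^ 2 ∂μ = 1 := by
  rw [← integral_condExp (ℱ.le k), integral_congr_ae (hη.condExp_sq k)]
  simp

/-- Orthogonality of the increments of the martingale transform with predictable bounded
coefficients `c`. -/
lemma integral_sum_sq [IsProbabilityMeasure μ] (hη : IsNormalizedMartingaleDiff ℱ η μ K)
    {c : ℕ → Ω → ℝ} (hc : ∀ k, StronglyMeasurable[ℱ k] (c k)) {b : ℕ → ℝ}
    (hb : ∀ k, ∀ᵐ ω ∂μ, |c k ω| ≤ b k) (n : ℕ) :
    ∫ ω, (∑ k ∈ Finset.range n, c k ω * η k ω) ^ 2 ∂μ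
      = ∑ k ∈ Finset.range n, ∫ ω, c k ω ^ 2 ∂μ := by
  have hc' : ∀ k, AEStronglyMeasurable (c k) μ :=
    fun k => ((hc k).mono (ℱ.le k)).aestronglyMeasurable
  induction n with
  | zero => simp
  | succ n ih =>
    set S : Ω → ℝ := fun ω => ∑ k ∈ Finset.range n, c k ω * η k ω with hS
    have hSm : StronglyMeasurable[ℱ n] S := hη.stronglyMeasurable_sum hc n
    have hS2 : MemLp S 2 μ := hη.memLp_sum hc' hb _
    have hcη := hη.memLp_mul (k := n) (hc' n) (hb n)
    have i1 : Integrable (fun ω => η n ω • (S ω * c n ω)) μ := by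
      refine (hS2.integrable_mul hcη).congr (ae_of_all _ fun ω => ?_)
      simp only [Pi.mul_apply, smul_eq_mul]; ring
    have i2 : Integrable (fun ω => η n ω ^ 2 • c n ω ^ 2) μ := by
      refine hcη.integrable_sq.congr (ae_of_all _ fun ω => ?_)
      simp only [smul_eq_mul]; ring
    have e1 : ∫ ω, η n ω • (S ω * c n ω) ∂μ = 0 := by
      rw [integral_smul_of_condExp_eq (ℱ.le n) (g := fun ω => S ω * c n ω)
        (hSm.mul (hc n)).aestronglyMeasurable i1
        ((hη.memLp n).integrable (by norm_num)) (hη.condExp_eq n)]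
      simp
    have e2 : ∫ ω, η n ω ^ 2 • c n ω ^ 2 ∂μ = ∫ ω, c n ω ^ 2 ∂μ := by
      rw [integral_smul_of_condExp_eq (ℱ.le n) (f := fun ω => η n ω ^ 2)
        (g := fun ω => c n ω ^ 2) ((hc n).pow 2).aestronglyMeasurable i2
        (hη.memLp_two n).integrable_sq (hη.condExp_sq n)]
      simp
    rw [Finset.sum_range_succ, ← ih, ← e2]
    have e3 : ∀ ω, (∑ k ∈ Finset.range (n + 1), c k ω * η k ω) ^ 2
        = S ω ^ 2 + 2 * (η n ω • (S ω * c n ω)) + η n ω ^ 2 • c n ω ^ 2 := fun ω => by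
      rw [Finset.sum_range_succ]
      simp only [hS, smul_eq_mul]
      ring
    simp_rw [e3]
    have j1 : Integrable (fun ω => 2 * (η n ω • (S ω * c n ω))) μ := i1.const_mul 2
    rw [integral_add (by exact hS2.integrable_sq.add j1) i2,
      integral_add hS2.integrable_sq j1, integral_const_mul, e1]
    ring

/-- Central limit theorem for triangular arrays of deterministic multiples of a normalized
martingale difference sequence, under a uniform smallness condition on the coefficients. -/
theorem tendstoInDistribution_sum [IsProbabilityMeasure μ]
    (hη : IsNormalizedMartingaleDiff ℱ η μ K) (w : ℕ → ℕ → ℝ)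
    (hw : ∀ᶠ n in atTop, ∑ k ∈ Finset.range n, w n k ^ 2 = 1)
    (hsmall : ∀ ε > 0, ∀ᶠ n in atTop, ∀ k < n, |w n k| ≤ ε) :
    TendstoInDistribution (fun n ω => ∑ k ∈ Finset.range n, w n k * η k ω) atTop (id : ℝ → ℝ)
      (fun _ => μ) (gaussianReal 0 1) where
  forall_aemeasurable n := Finset.aemeasurable_fun_sum _ fun k _ =>
    (hη.memLp k).aestronglyMeasurable.aemeasurable.const_mul _
  tendsto := by
    have hm : ∀ n, AEMeasurable (fun ω => ∑ k ∈ Finset.range n, w n k * η k ω) μ := fun n =>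
      Finset.aemeasurable_fun_sum _ fun k _ =>
        (hη.memLp k).aestronglyMeasurable.aemeasurable.const_mul _
    have hK : 0 ≤ K := (integral_nonneg fun ω => by positivity).trans (hη.moment_four_le 0)
    refine ProbabilityMeasure.tendsto_iff_tendsto_charFun.2 fun θ => ?_
    have e0 : charFun (Measure.map id (gaussianReal 0 1)) θ = Real.exp (-(θ ^ 2 / 2)) := by
      rw [Measure.map_id, charFun_gaussianReal]
      push_cast
      congr 1
      simp
    have e1 : ∀ n, charFun (μ.map fun ω => ∑ k ∈ Finset.range n, w n k * η k ω) θ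
        = ∫ ω, Complex.exp ((θ * ∑ k ∈ Finset.range n, w n k * η k ω : ℝ) * Complex.I) ∂μ :=
      fun n => by
        rw [charFun_apply_real, integral_map (hm n) (by fun_prop)]
        simp
    simp only [ProbabilityMeasure.coe_mk, e0, e1]
    rw [tendsto_iff_norm_sub_tendsto_zero, Metric.tendsto_atTop']
    intro δ hδ
    set a := 4 * |θ| ^ 3 * (1 + K) with ha
    have ha0 : 0 ≤ a := by positivity
    have hlim : Tendsto (fun ε : ℝ => a * ε + θ ^ 4 * ε ^ 2) (𝓝[>] 0) (𝓝 0) := by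
      have : Continuous fun ε : ℝ => a * ε + θ ^ 4 * ε ^ 2 := by fun_prop
      simpa using (this.tendsto 0).mono_left nhdsWithin_le_nhds
    obtain ⟨ε, hεδ, hε⟩ := ((hlim.eventually_lt_const hδ).and self_mem_nhdsWithin).exists
    have hε : 0 < ε := hε
    obtain ⟨N, hN⟩ := eventually_atTop.1 (hw.and (hsmall ε hε))
    refine ⟨N, fun n hn => ?_⟩
    obtain ⟨h1, h2⟩ := hN n hn.le
    rw [dist_zero_right, norm_norm]
    have h3 := hη.norm_charFun_sub_le (w n) θ n
    rw [h1, mul_one] at h3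
    refine (h3.trans ?_).trans_lt hεδ
    calc ∑ k ∈ Finset.range n, (4 * |θ * w n k| ^ 3 * (1 + K) + (θ * w n k) ^ 4)
        ≤ ∑ k ∈ Finset.range n, (a * ε + θ ^ 4 * ε ^ 2) * w n k ^ 2 := by
          refine Finset.sum_le_sum fun k hk => ?_
          have h4 := h2 k (Finset.mem_range.1 hk)
          have h5 : w n k ^ 2 ≤ ε ^ 2 := by
            rw [← sq_abs]
            exact pow_le_pow_left₀ (abs_nonneg _) h4 2
          calc 4 * |θ * w n k| ^ 3 * (1 + K) + (θ * w n k) ^ 4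
              = a * (|w n k| * |w n k| ^ 2) + θ ^ 4 * (w n k ^ 2 * w n k ^ 2) := by
                rw [abs_mul, ha]; ring
            _ ≤ a * (ε * |w n k| ^ 2) + θ ^ 4 * (ε ^ 2 * w n k ^ 2) := by gcongr
            _ = _ := by rw [sq_abs]; ring
      _ = a * ε + θ ^ 4 * ε ^ 2 := by rw [← Finset.mul_sum, h1, mul_one]

/-! ### The self-normalized martingale central limit theorem -/

/-- Replacing predictable factors `ρ k` by their limit `ρs` changes a weighted sum of martingale
differences by an amount vanishing in `L¹`. The limit is not adapted, so it is approximated by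
`ρ m`, with `m` large and fixed, to make orthogonality of the increments available. -/
lemma tendsto_integral_abs_sum_sub [IsProbabilityMeasure μ]
    (hη : IsNormalizedMartingaleDiff ℱ η μ K) {w : ℕ → ℕ → ℝ}
    (hw : ∀ᶠ n in atTop, ∑ k ∈ Finset.range n, w n k ^ 2 = 1)
    (hw0 : ∀ k, Tendsto (fun n => w n k) atTop (𝓝 0))
    {ρ : ℕ → Ω → ℝ} {ρs : Ω → ℝ} {c C : ℝ} (hc : 0 < c)
    (hρ : ∀ k, StronglyMeasurable[ℱ k] (ρ k)) (hρs : AEStronglyMeasurable ρs μ)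
    (hρb : ∀ k, ∀ᵐ ω ∂μ, ρ k ω ∈ Set.Icc c C) (hρsb : ∀ᵐ ω ∂μ, ρs ω ∈ Set.Icc c C)
    (hd : Tendsto (fun k => ∫ ω, |ρ k ω - ρs ω| ∂μ) atTop (𝓝 0)) :
    Tendsto (fun n => ∫ ω, |∑ k ∈ Finset.range n, w n k * ((ρ k ω - ρs ω) * η k ω)| ∂μ)
      atTop (𝓝 0) := by
  have hρm : ∀ k, AEStronglyMeasurable (ρ k) μ :=
    fun k => ((hρ k).mono (ℱ.le k)).aestronglyMeasurable
  have hC : 0 ≤ C := by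
    obtain ⟨ω, hω⟩ := hρsb.exists
    exact hc.le.trans (hω.1.trans hω.2)
  have habs : ∀ {x y : ℝ}, x ∈ Set.Icc c C → y ∈ Set.Icc c C → |x - y| ≤ C := by
    rintro x y ⟨h1, h2⟩ ⟨h3, h4⟩
    rw [abs_le]; constructor <;> linarith
  have hbs : ∀ k, ∀ᵐ ω ∂μ, |ρ k ω - ρs ω| ≤ C := fun k => by
    filter_upwards [hρb k, hρsb] with ω h1 h2 using habs h1 h2
  have hbm : ∀ k m, ∀ᵐ ω ∂μ, |ρ k ω - ρ m ω| ≤ C := fun k m => by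
    filter_upwards [hρb k, hρb m] with ω h1 h2 using habs h1 h2
  have his : ∀ k, Integrable (fun ω => |ρ k ω - ρs ω|) μ := fun k =>
    (Integrable.of_bound ((hρm k).sub hρs) C (by simpa using hbs k)).abs
  have hsqs : ∀ m, ∫ ω, (ρ m ω - ρs ω) ^ 2 ∂μ ≤ C * ∫ ω, |ρ m ω - ρs ω| ∂μ := fun m => by
    rw [← integral_const_mul]
    refine integral_mono_of_nonneg (ae_of_all _ fun ω => sq_nonneg _) ((his m).const_mul C) ?_
    filter_upwards [hbs m] with ω h1
    rw [← sq_abs, sq]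
    gcongr
  have hsqm : ∀ k m, ∫ ω, (ρ k ω - ρ m ω) ^ 2 ∂μ
      ≤ C * (∫ ω, |ρ k ω - ρs ω| ∂μ + ∫ ω, |ρ m ω - ρs ω| ∂μ) := fun k m => by
    rw [← integral_add (his k) (his m), ← integral_const_mul]
    refine integral_mono_of_nonneg (ae_of_all _ fun ω => sq_nonneg _)
      (((his k).add (his m)).const_mul C) ?_
    filter_upwards [hbm k m] with ω h1
    have h2 : |ρ k ω - ρ m ω| ≤ |ρ k ω - ρs ω| + |ρ m ω - ρs ω| := by
      rw [abs_sub_comm (ρ m ω)]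
      exact abs_sub_le _ _ _
    calc (ρ k ω - ρ m ω) ^ 2 = |ρ k ω - ρ m ω| * |ρ k ω - ρ m ω| := by rw [← sq_abs, sq]
      _ ≤ C * (|ρ k ω - ρs ω| + |ρ m ω - ρs ω|) := by gcongr
  have hη1 : ∀ k, ∫ ω, |η k ω| ∂μ ≤ 1 := fun k => by
    simpa [hη.integral_sq_eq_one k] using integral_abs_le_sqrt (hη.memLp_two k)
  -- the error made by stopping the approximation at `m`
  have bound : ∀ (ε : ℝ) (m n : ℕ), m ≤ n → ∑ k ∈ Finset.range n, w n k ^ 2 = 1 →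
      (∀ k ≥ m, ∫ ω, |ρ k ω - ρs ω| ∂μ ≤ ε) →
      ∫ ω, |∑ k ∈ Finset.range n, w n k * ((ρ k ω - ρs ω) * η k ω)| ∂μ
        ≤ √(C * (ε + ε)) + C * (∑ k ∈ Finset.range m, |w n k|) + √(C * ε) := by
    intro ε m n hmn hwn hε
    set a : ℕ → Ω → ℝ := fun k ω => if m ≤ k then w n k * (ρ k ω - ρ m ω) else 0 with ha
    have ham : ∀ k, StronglyMeasurable[ℱ k] (a k) := fun k => by
      simp only [ha]
      split_ifs with h
      · exact ((hρ k).sub ((hρ m).mono (ℱ.mono h))).const_mul _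
      · exact stronglyMeasurable_const
    have hab : ∀ k, ∀ᵐ ω ∂μ, |a k ω| ≤ |w n k| * C := fun k => by
      filter_upwards [hbm k m] with ω h1
      simp only [ha]
      split_ifs with h
      · rw [abs_mul]; gcongr
      · simpa using by positivity
    have ham' : ∀ k, AEStronglyMeasurable (a k) μ :=
      fun k => ((ham k).mono (ℱ.le k)).aestronglyMeasurable
    have hS1 := hη.memLp_sum ham' hab (Finset.range n)
    have hS2 : MemLp (fun ω => ∑ k ∈ Finset.range m, w n k * (ρ k ω - ρ m ω) * η k ω) 2 μ := by
      refine hη.memLp_sum (c := fun k ω => w n k * (ρ k ω - ρ m ω)) (b := fun k => |w n k| * C)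
        (fun k => ((hρm k).sub (hρm m)).const_mul _) (fun k => ?_) _
      filter_upwards [hbm k m] with ω h1
      rw [abs_mul]; gcongr
    have hT : MemLp (fun ω => ∑ k ∈ Finset.range n, w n k * η k ω) 2 μ :=
      hη.memLp_sum (c := fun k _ => w n k) (b := fun k => |w n k|)
        (fun k => aestronglyMeasurable_const) (fun k => ae_of_all _ fun _ => le_rfl) _
    have hρms : MemLp (fun ω => ρ m ω - ρs ω) 2 μ :=
      MemLp.of_bound ((hρm m).sub hρs) C (by simpa using hbs m)
    have hT1 : ∫ ω, (∑ k ∈ Finset.range n, w n k * η k ω) ^ 2 ∂μ = 1 := by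
      rw [hη.integral_sum_sq (c := fun k _ => w n k) (fun k => stronglyMeasurable_const)
        (b := fun k => |w n k|) (fun k => ae_of_all _ fun _ => le_rfl)]
      simpa using hwn
    have dec : ∀ ω, ∑ k ∈ Finset.range n, w n k * ((ρ k ω - ρs ω) * η k ω)
        = ∑ k ∈ Finset.range n, a k ω * η k ω
          + ∑ k ∈ Finset.range m, w n k * (ρ k ω - ρ m ω) * η k ω
          + (ρ m ω - ρs ω) * ∑ k ∈ Finset.range n, w n k * η k ω := fun ω => by
      have e : Finset.range m = (Finset.range n).filter (fun k => k < m) := by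
        ext k; simp only [Finset.mem_range, Finset.mem_filter]; omega
      rw [e, Finset.sum_filter, Finset.mul_sum, ← Finset.sum_add_distrib,
        ← Finset.sum_add_distrib]
      refine Finset.sum_congr rfl fun k _ => ?_
      simp only [ha]
      rcases le_or_gt m k with h | h
      · rw [if_pos h, if_neg (not_lt.2 h)]; ring
      · rw [if_neg (not_le.2 h), if_pos h]; ring
    have j1 := (hS1.integrable (by norm_num)).abs
    have j2 := (hS2.integrable (by norm_num)).abs
    have j3 : Integrable
        (fun ω => |(ρ m ω - ρs ω) * ∑ k ∈ Finset.range n, w n k * η k ω|) μ :=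
      (hρms.integrable_mul hT).abs
    have t1 : ∫ ω, |∑ k ∈ Finset.range n, a k ω * η k ω| ∂μ ≤ √(C * (ε + ε)) := by
      refine (integral_abs_le_sqrt hS1).trans (Real.sqrt_le_sqrt ?_)
      rw [hη.integral_sum_sq ham hab]
      calc ∑ k ∈ Finset.range n, ∫ ω, a k ω ^ 2 ∂μ
          ≤ ∑ k ∈ Finset.range n, w n k ^ 2 * (C * (ε + ε)) := by
            refine Finset.sum_le_sum fun k _ => ?_
            have hε0 : 0 ≤ ε := (integral_nonneg fun ω => abs_nonneg _).trans (hε m le_rfl)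
            rcases le_or_gt m k with h | h
            · simp only [ha, if_pos h, mul_pow]
              rw [integral_const_mul]
              refine mul_le_mul_of_nonneg_left ((hsqm k m).trans ?_) (sq_nonneg _)
              exact mul_le_mul_of_nonneg_left (add_le_add (hε k h) (hε m le_rfl)) hC
            · simp only [ha, if_neg (not_le.2 h)]
              simp only [ne_eq, OfNat.ofNat_ne_zero, not_false_eq_true, zero_pow, integral_zero]
              positivity
        _ = C * (ε + ε) := by rw [← Finset.sum_mul, hwn, one_mul]
    have t2 : ∫ ω, |∑ k ∈ Finset.range m, w n k * (ρ k ω - ρ m ω) * η k ω| ∂μ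
        ≤ C * (∑ k ∈ Finset.range m, |w n k|) := by
      have iη : ∀ k, Integrable (fun ω => |η k ω|) μ := fun k =>
        ((hη.memLp k).integrable (by norm_num)).abs
      calc _ ≤ ∫ ω, ∑ k ∈ Finset.range m, |w n k| * C * |η k ω| ∂μ := by
            refine integral_mono_ae j2
              (integrable_finsetSum _ fun k _ => (iη k).const_mul _) ?_
            filter_upwards [ae_all_iff.2 fun k => hbm k m] with ω h1
            refine (Finset.abs_sum_le_sum_abs _ _).trans (Finset.sum_le_sum fun k _ => ?_)
            rw [abs_mul, abs_mul]
            have := h1 k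
            gcongr
        _ = ∑ k ∈ Finset.range m, |w n k| * C * ∫ ω, |η k ω| ∂μ := by
            rw [integral_finsetSum _ fun k _ => (iη k).const_mul _]
            simp_rw [integral_const_mul]
        _ ≤ ∑ k ∈ Finset.range m, |w n k| * C * 1 := by
            refine Finset.sum_le_sum fun k _ => ?_
            have := hη1 k
            gcongr
        _ = _ := by simp_rw [mul_one]; rw [← Finset.sum_mul, mul_comm]
    have t3 : ∫ ω, |(ρ m ω - ρs ω) * ∑ k ∈ Finset.range n, w n k * η k ω| ∂μ ≤ √(C * ε) := by
      refine (integral_abs_mul_le_sqrt hρms hT).trans ?_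
      rw [hT1, Real.sqrt_one, mul_one]
      refine Real.sqrt_le_sqrt ((hsqs m).trans ?_)
      exact mul_le_mul_of_nonneg_left (hε m le_rfl) hC
    refine le_trans ?_ (add_le_add (add_le_add t1 t2) t3)
    rw [← integral_add j1 j2, ← integral_add (by exact j1.add j2) j3]
    refine integral_mono_of_nonneg (ae_of_all _ fun ω => abs_nonneg _) ((j1.add j2).add j3)
      (ae_of_all _ fun ω => ?_)
    simp only [dec]
    exact (abs_add_le _ _).trans (add_le_add (abs_add_le _ _) le_rfl)
  rw [Metric.tendsto_atTop']
  intro δ hδ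
  have hlim : Tendsto (fun ε : ℝ => √(C * (ε + ε)) + √(C * ε)) (𝓝[>] 0) (𝓝 0) := by
    have : Continuous fun ε : ℝ => √(C * (ε + ε)) + √(C * ε) := by fun_prop
    simpa using (this.tendsto 0).mono_left nhdsWithin_le_nhds
  obtain ⟨ε, hεδ, hε⟩ := ((hlim.eventually_lt_const (half_pos hδ)).and self_mem_nhdsWithin).exists
  have hε : 0 < ε := hε
  obtain ⟨m, hm⟩ := eventually_atTop.1 (hd.eventually_le_const hε)
  have hsum : Tendsto (fun n => C * (∑ k ∈ Finset.range m, |w n k|)) atTop (𝓝 0) := by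
    have := (tendsto_finsetSum (Finset.range m) fun k _ => (hw0 k).abs).const_mul C
    simpa using this
  obtain ⟨N, hN⟩ := eventually_atTop.1
    ((hw.and (hsum.eventually_lt_const (half_pos hδ))).and (eventually_ge_atTop m))
  refine ⟨N, fun n hn => ?_⟩
  obtain ⟨⟨h1, h2⟩, h3⟩ := hN n hn.le
  rw [dist_zero_right, Real.norm_of_nonneg (integral_nonneg fun ω => abs_nonneg _)]
  have := bound ε m n h3 h1 hm
  linarith

/-- Self-normalized martingale central limit theorem. The predictable standard deviations
`r k * ρ k` have a deterministic part `r k` satisfying a Lindeberg-type negligibility condition, and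
a random part `ρ k` that converges in probability to a possibly random limit. The initial data `A` and `B`
are washed out by the normalization. -/
theorem tendstoInDistribution_selfNormalized [IsProbabilityMeasure μ]
    (hη : IsNormalizedMartingaleDiff ℱ η μ K) {r : ℕ → ℝ}
    (hR : Tendsto (fun n => ∑ k ∈ Finset.range n, r k ^ 2) atTop atTop)
    (hr : ∀ ε > 0, ∀ᶠ n in atTop, ∀ k < n, r k ^ 2 ≤ ε * ∑ k ∈ Finset.range n, r k ^ 2)
    {ρ : ℕ → Ω → ℝ} {ρs : Ω → ℝ} {c C : ℝ} (hc : 0 < c)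
    (hρ : ∀ k, StronglyMeasurable[ℱ k] (ρ k)) (hρs : AEMeasurable ρs μ)
    (hρb : ∀ k, ∀ᵐ ω ∂μ, ρ k ω ∈ Set.Icc c C) (hρsb : ∀ᵐ ω ∂μ, ρs ω ∈ Set.Icc c C)
    (hlim : TendstoInMeasure μ ρ atTop ρs)
    {A B : Ω → ℝ} (hA : AEMeasurable A μ) (hB : AEMeasurable B μ) :
    TendstoInDistribution
      (fun n ω => (A ω + ∑ k ∈ Finset.range n, r k * (ρ k ω * η k ω))
        / √(B ω + ∑ k ∈ Finset.range n, r k ^ 2 * ρ k ω ^ 2))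
      atTop (id : ℝ → ℝ) (fun _ => μ) (gaussianReal 0 1) := by
  set R : ℕ → ℝ := fun n => ∑ k ∈ Finset.range n, r k ^ 2 with hRdef
  have hρm : ∀ k, AEMeasurable (ρ k) μ :=
    fun k => ((hρ k).mono (ℱ.le k)).measurable.aemeasurable
  have hηm : ∀ k, AEMeasurable (η k) μ := fun k => (hη.memLp k).aestronglyMeasurable.aemeasurable
  have hRpos : ∀ᶠ n in atTop, 0 < R n := hR.eventually_gt_atTop 0
  set w : ℕ → ℕ → ℝ := fun n k => r k / √(R n) with hwdef
  have hw : ∀ᶠ n in atTop, ∑ k ∈ Finset.range n, w n k ^ 2 = 1 := by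
    filter_upwards [hRpos] with n hn
    simp only [hwdef, div_pow, Real.sq_sqrt hn.le]
    rw [← Finset.sum_div]
    exact div_self hn.ne'
  have hsqrtR : Tendsto (fun n => √(R n)) atTop atTop := Real.tendsto_sqrt_atTop.comp hR
  have hw0 : ∀ k, Tendsto (fun n => w n k) atTop (𝓝 0) := fun k => hsqrtR.const_div_atTop _
  have hsmall : ∀ ε > 0, ∀ᶠ n in atTop, ∀ k < n, |w n k| ≤ ε := fun ε hε => by
    filter_upwards [hRpos, hr (ε ^ 2) (by positivity)] with n hn h k hk
    refine abs_le_of_sq_le_sq ?_ hε.le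
    simp only [hwdef, div_pow, Real.sq_sqrt hn.le]
    rw [div_le_iff₀ hn]
    exact h k hk
  -- the normalized martingale
  set T : ℕ → Ω → ℝ := fun n ω => ∑ k ∈ Finset.range n, w n k * η k ω with hT
  have hTlim : TendstoInDistribution T atTop (id : ℝ → ℝ) (fun _ => μ) (gaussianReal 0 1) :=
    hη.tendstoInDistribution_sum w hw hsmall
  have hC : 0 ≤ C := by
    obtain ⟨ω, hω⟩ := hρsb.exists
    exact hc.le.trans (hω.1.trans hω.2)
  have hbs : ∀ k, ∀ᵐ ω ∂μ, |ρ k ω - ρs ω| ≤ C := fun k => by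
    filter_upwards [hρb k, hρsb] with ω h1 h2
    rw [abs_le]; constructor <;> linarith [h1.1, h1.2, h2.1, h2.2]
  have hd := tendsto_integral_abs_sub_of_tendstoInMeasure hlim
    (fun k => (hρm k).aestronglyMeasurable) hρs.aestronglyMeasurable hbs
  have his : ∀ k, Integrable (fun ω => ρ k ω - ρs ω) μ := fun k =>
    Integrable.of_bound ((hρm k).sub hρs).aestronglyMeasurable C (by simpa using hbs k)
  -- the numerator
  set D : ℕ → Ω → ℝ := fun n ω => ∑ k ∈ Finset.range n, w n k * ((ρ k ω - ρs ω) * η k ω) with hD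
  have hDm : ∀ n, AEMeasurable (D n) μ := fun n =>
    Finset.aemeasurable_fun_sum _ fun k _ => (((hρm k).sub hρs).mul (hηm k)).const_mul _
  have hDi : ∀ n, Integrable (D n) μ := fun n =>
    integrable_finsetSum _ fun k _ => ((hη.memLp_mul ((hρm k).sub hρs).aestronglyMeasurable
      (hbs k)).integrable (by norm_num)).const_mul _
  have hDlim : TendstoInMeasure μ D atTop (fun _ => 0) :=
    tendstoInMeasure_zero_of_tendsto_integral_abs hDi
      (hη.tendsto_integral_abs_sum_sub hw hw0 hc hρ hρs.aestronglyMeasurable hρb hρsb hd)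
  have hAlim : TendstoInMeasure μ (fun n ω => A ω / √(R n)) atTop (fun _ => 0) :=
    tendstoInMeasure_of_tendsto_ae (fun n => (hA.div_const _).aestronglyMeasurable)
      (ae_of_all _ fun ω => hsqrtR.const_div_atTop _)
  have hnum : TendstoInMeasure μ (fun n ω => A ω / √(R n) + D n ω) atTop (fun _ => 0 + 0) :=
    tendstoInMeasure_comp₂ hAlim hDlim (f := fun p => p.1 + p.2)
      (ae_of_all _ fun ω => by fun_prop)
      (fun n => ((hA.div_const _).add (hDm n)).aestronglyMeasurable)
  -- the denominator
  have hBlim : TendstoInMeasure μ (fun n ω => B ω / R n) atTop (fun _ => 0) :=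
    tendstoInMeasure_of_tendsto_ae (fun n => (hB.div_const _).aestronglyMeasurable)
      (ae_of_all _ fun ω => hR.const_div_atTop _)
  set v : ℕ → Ω → ℝ :=
    fun n ω => (∑ k ∈ Finset.range n, r k ^ 2 * (ρ k ω ^ 2 - ρs ω ^ 2)) / R n with hv
  have hsq : ∀ k, ∀ᵐ ω ∂μ, |ρ k ω ^ 2 - ρs ω ^ 2| ≤ 2 * C * |ρ k ω - ρs ω| := fun k => by
    filter_upwards [hρb k, hρsb] with ω h1 h2
    have h3 : |ρ k ω + ρs ω| ≤ 2 * C := by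
      rw [abs_le]; constructor <;> linarith [h1.1, h1.2, h2.1, h2.2]
    rw [sq_sub_sq, abs_mul]
    gcongr
  have hisq : ∀ k, Integrable (fun ω => ρ k ω ^ 2 - ρs ω ^ 2) μ := fun k =>
    ((his k).abs.const_mul (2 * C)).mono'
      (((hρm k).pow_const 2).sub (hρs.pow_const 2)).aestronglyMeasurable (hsq k)
  have hvm : ∀ n, AEMeasurable (v n) μ := fun n =>
    (Finset.aemeasurable_fun_sum _ fun k _ =>
      (((hρm k).pow_const 2).sub (hρs.pow_const 2)).const_mul _).div_const _
  have hvi : ∀ n, Integrable (v n) μ := fun n =>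
    (integrable_finsetSum _ fun k _ => (hisq k).const_mul _).div_const _
  have hvlim : TendstoInMeasure μ v atTop (fun _ => 0) := by
    refine tendstoInMeasure_zero_of_tendsto_integral_abs hvi ?_
    have hces : Tendsto (fun n => (∑ k ∈ Finset.range n,
        r k ^ 2 * (2 * C * ∫ ω, |ρ k ω - ρs ω| ∂μ)) / R n) atTop (𝓝 0) := by
      refine (IsLittleO.sum_range (g := fun k => r k ^ 2) ?_ (fun k => sq_nonneg _)
        hR).tendsto_div_nhds_zero
      have h0 : (fun k => 2 * C * ∫ ω, |ρ k ω - ρs ω| ∂μ) =o[atTop] fun _ => (1 : ℝ) := by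
        rw [isLittleO_one_iff]
        simpa using hd.const_mul (2 * C)
      simpa using (isBigO_refl (fun k => r k ^ 2) atTop).mul_isLittleO h0
    refine squeeze_zero (fun n => integral_nonneg fun ω => abs_nonneg _) (fun n => ?_) hces
    have hR0 : 0 ≤ R n := Finset.sum_nonneg fun k _ => sq_nonneg _
    have hint : ∀ k, Integrable (fun ω => r k ^ 2 * (2 * C * |ρ k ω - ρs ω|)) μ :=
      fun k => ((his k).abs.const_mul _).const_mul _
    calc ∫ ω, |v n ω| ∂μ
        ≤ ∫ ω, (∑ k ∈ Finset.range n, r k ^ 2 * (2 * C * |ρ k ω - ρs ω|)) / R n ∂μ := by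
          refine integral_mono_ae (hvi n).abs
            ((integrable_finsetSum _ fun k _ => hint k).div_const _) ?_
          filter_upwards [ae_all_iff.2 hsq] with ω h1
          simp only [hv, abs_div, abs_of_nonneg hR0]
          gcongr
          refine (Finset.abs_sum_le_sum_abs _ _).trans (Finset.sum_le_sum fun k _ => ?_)
          rw [abs_mul, abs_of_nonneg (sq_nonneg (r k))]
          have := h1 k
          gcongr
      _ = _ := by
          rw [integral_div, integral_finsetSum _ fun k _ => hint k]
          simp_rw [integral_const_mul]
  have hBv : TendstoInMeasure μ (fun n ω => B ω / R n + v n ω) atTop (fun _ => 0 + 0) :=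
    tendstoInMeasure_comp₂ hBlim hvlim (f := fun p => p.1 + p.2)
      (ae_of_all _ fun ω => by fun_prop)
      (fun n => ((hB.div_const _).add (hvm n)).aestronglyMeasurable)
  have hBvm : ∀ n, AEMeasurable (fun ω => B ω / R n + v n ω) μ :=
    fun n => (hB.div_const _).add (hvm n)
  have hconst : TendstoInMeasure μ (fun _ : ℕ => ρs) atTop ρs :=
    tendstoInMeasure_of_tendsto_ae (fun _ => hρs.aestronglyMeasurable)
      (ae_of_all _ fun ω => tendsto_const_nhds)
  set Z : ℕ → Ω → ℝ := fun n ω => (√(B ω / R n + v n ω + ρs ω ^ 2))⁻¹ with hZ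
  have hZm : ∀ n, AEMeasurable (Z n) μ :=
    fun n => (((hBvm n).add (hρs.pow_const 2)).sqrt).inv
  have hZlim : TendstoInMeasure μ Z atTop (fun ω => (√(0 + 0 + ρs ω ^ 2))⁻¹) := by
    refine tendstoInMeasure_comp₂ hBv hconst (f := fun p => (√(p.1 + p.2 ^ 2))⁻¹) ?_
      (fun n => (hZm n).aestronglyMeasurable)
    filter_upwards [hρsb] with ω h
    have h1 : 0 < ρs ω := hc.trans_le h.1
    refine ContinuousAt.inv₀ (by fun_prop) ?_
    simp only [add_zero, zero_add, Real.sqrt_sq h1.le]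
    exact h1.ne'
  have hY : TendstoInMeasure μ (fun n ω => ρs ω * Z n ω) atTop (fun _ => 1) := by
    have := tendstoInMeasure_comp₂ hconst hZlim (f := fun p => p.1 * p.2)
      (ae_of_all _ fun ω => by fun_prop) (fun n => (hρs.mul (hZm n)).aestronglyMeasurable)
    refine this.congr_right ?_
    filter_upwards [hρsb] with ω h
    have h1 : 0 < ρs ω := hc.trans_le h.1
    simp only [add_zero, zero_add, Real.sqrt_sq h1.le]
    exact mul_inv_cancel₀ h1.ne'
  have hE : TendstoInMeasure μ (fun n ω => (A ω / √(R n) + D n ω) * Z n ω) atTop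
      (fun _ => 0) := by
    have := tendstoInMeasure_comp₂ hnum hZlim (f := fun p => p.1 * p.2)
      (ae_of_all _ fun ω => by fun_prop)
      (fun n => (((hA.div_const _).add (hDm n)).mul (hZm n)).aestronglyMeasurable)
    exact this.congr_right (ae_of_all _ fun ω => by simp)
  have hTY : TendstoInDistribution (fun n ω => T n ω * (ρs ω * Z n ω)) atTop (id : ℝ → ℝ)
      (fun _ => μ) (gaussianReal 0 1) := by
    have := hTlim.continuous_comp_prodMk_of_tendstoInMeasure_const (g := fun p => p.1 * p.2)
      (by fun_prop) hY (fun n => hρs.mul (hZm n))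
    simp only [id_eq, mul_one] at this
    exact this
  refine tendstoInDistribution_of_tendstoInMeasure_sub
    (X := fun n ω => T n ω * (ρs ω * Z n ω)) _ _ hTY
    ?_ (fun n => ?_)
  · refine hE.congr' ?_ (ae_of_all _ fun _ => rfl)
    filter_upwards [hRpos] with n hn
    refine ae_of_all _ fun ω => ?_
    have hs : 0 < √(R n) := Real.sqrt_pos.2 hn
    have e1 : B ω + ∑ k ∈ Finset.range n, r k ^ 2 * ρ k ω ^ 2
        = R n * (B ω / R n + v n ω + ρs ω ^ 2) := by
      simp only [hv, mul_sub, Finset.sum_sub_distrib, ← Finset.sum_mul]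
      change _ = R n * (B ω / R n + (_ - R n * _) / R n + _)
      field_simp
      ring
    have e2 : A ω + ∑ k ∈ Finset.range n, r k * (ρ k ω * η k ω)
        = √(R n) * (A ω / √(R n) + D n ω + ρs ω * T n ω) := by
      have : D n ω + ρs ω * T n ω
          = (∑ k ∈ Finset.range n, r k * (ρ k ω * η k ω)) / √(R n) := by
        simp only [hD, hT, hwdef]
        rw [Finset.mul_sum, ← Finset.sum_add_distrib, Finset.sum_div]
        refine Finset.sum_congr rfl fun k _ => ?_
        ring
      rw [add_assoc, this]
      field_simp
    simp only [Pi.sub_apply]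
    rw [e1, e2, Real.sqrt_mul hn.le, mul_div_mul_left _ _ hs.ne', div_eq_mul_inv]
    simp only [hZ]
    ring
  · exact (hA.add (Finset.aemeasurable_fun_sum _ fun k _ =>
      ((hρm k).mul (hηm k)).const_mul _)).div (hB.add (Finset.aemeasurable_fun_sum _ fun k _ =>
        ((hρm k).pow_const 2).const_mul _)).sqrt

end IsNormalizedMartingaleDiff

end Prob

/-! ### Regularity of the weights -/

section Weights

/-- The scale `g k / ∏_{j ≤ k} (1 - g j)` of the `k`-th increment once the recursion
`M ↦ (1 - g k) M + ξ` has been divided by the running product of its coefficients. -/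
noncomputable def weight (g : ℕ → ℝ) (k : ℕ) : ℝ := g k / ∏ j ∈ Finset.range (k + 1), (1 - g j)

variable {g : ℕ → ℝ}

lemma weight_pos (h0 : ∀ k, 0 < g k) (h1 : ∀ k, g k < 1) (k : ℕ) : 0 < weight g k :=
  div_pos (h0 k) (Finset.prod_pos fun j _ => sub_pos.2 (h1 j))

lemma weight_succ (h0 : ∀ k, 0 < g k) (k : ℕ) :
    weight g (k + 1) = g (k + 1) / g k / (1 - g (k + 1)) * weight g k := by
  have := (h0 k).ne'
  rw [weight, weight, Finset.prod_range_succ _ (k + 1)]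
  field_simp

/-- The rate condition on `g` says exactly that the weights do not decrease. -/
lemma weight_le_succ (h0 : ∀ k, 0 < g k) (h1 : ∀ k, g k < 1)
    (hrate : ∀ k, 1 / g (k + 1) - 1 / g k ≤ 1) (k : ℕ) : weight g k ≤ weight g (k + 1) := by
  rw [weight_succ h0]
  refine le_mul_of_one_le_left (weight_pos h0 h1 k).le ?_
  have a := h0 k
  have b := h0 (k + 1)
  rw [one_le_div (sub_pos.2 (h1 _)), le_div_iff₀ a]
  have := hrate k
  rw [div_sub_div _ _ b.ne' a.ne', div_le_one (mul_pos b a)] at this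
  linarith

lemma tendsto_sum_weight_sq (h0 : ∀ k, 0 < g k) (h1 : ∀ k, g k < 1)
    (hrate : ∀ k, 1 / g (k + 1) - 1 / g k ≤ 1) :
    Tendsto (fun n => ∑ k ∈ Finset.range n, weight g k ^ 2) atTop atTop := by
  have hmono := monotone_nat_of_le_succ (weight_le_succ h0 h1 hrate)
  have hp := weight_pos h0 h1 0
  have : Tendsto (fun n : ℕ => (n : ℝ) * weight g 0 ^ 2) atTop atTop :=
    tendsto_natCast_atTop_atTop.atTop_mul_const (by positivity)
  refine tendsto_atTop_mono (fun n => ?_) this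
  calc (n : ℝ) * weight g 0 ^ 2 = ∑ k ∈ Finset.range n, weight g 0 ^ 2 := by simp
    _ ≤ _ := Finset.sum_le_sum fun k _ => pow_le_pow_left₀ hp.le (hmono (Nat.zero_le k)) 2

/-- No single weight carries a positive fraction of the total: the last weight is the largest, and
since consecutive weights are asymptotically equal, arbitrarily many weights are comparable to
it. -/
lemma eventually_weight_sq_le (h0 : ∀ k, 0 < g k) (h1 : ∀ k, g k < 1)
    (hrate : ∀ k, 1 / g (k + 1) - 1 / g k ≤ 1) (hzero : Tendsto g atTop (𝓝 0))
    (hratio : Tendsto (fun k => g (k + 1) / g k) atTop (𝓝 1)) {ε : ℝ} (hε : 0 < ε) :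
    ∀ᶠ n in atTop, ∀ k < n, weight g k ^ 2 ≤ ε * ∑ j ∈ Finset.range n, weight g j ^ 2 := by
  have hmono := monotone_nat_of_le_succ (weight_le_succ h0 h1 hrate)
  have hp := weight_pos h0 h1
  have hq : Tendsto (fun k => (g (k + 1) / g k / (1 - g (k + 1))) ^ 2) atTop (𝓝 1) := by
    have := (hratio.div ((hzero.comp (tendsto_add_atTop_nat 1)).const_sub 1) (by simp)).pow 2
    simpa using this
  have key : ∀ K : ℕ, ∀ᶠ n in atTop,
      (K : ℝ) / 2 * weight g n ^ 2 ≤ ∑ j ∈ Finset.range n, weight g j ^ 2 := by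
    intro K
    induction K with
    | zero =>
      refine Eventually.of_forall fun n => ?_
      simpa using Finset.sum_nonneg fun k _ => sq_nonneg (weight g k)
    | succ K ih =>
      have hlt : (1 : ℝ) < (K + 2) / (K + 1) := by
        rw [one_lt_div (by positivity)]; linarith
      obtain ⟨N, hN⟩ := eventually_atTop.1 (ih.and (hq.eventually_le_const hlt))
      filter_upwards [eventually_ge_atTop (N + 1)] with n hn
      obtain ⟨n, rfl⟩ : ∃ k, n = k + 1 := ⟨n - 1, by omega⟩
      obtain ⟨ha, hb⟩ := hN n (by omega)
      rw [Finset.sum_range_succ, weight_succ h0, mul_pow]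
      rw [le_div_iff₀ (by positivity)] at hb
      push_cast
      nlinarith [mul_le_mul_of_nonneg_right hb (sq_nonneg (weight g n))]
  obtain ⟨K, hK⟩ := exists_nat_gt (2 / ε)
  filter_upwards [key K] with n hn k hk
  have h2 : weight g k ^ 2 ≤ weight g n ^ 2 := pow_le_pow_left₀ (hp k).le (hmono hk.le) 2
  have h3 : 1 ≤ ε * (K / 2) := by
    rw [div_lt_iff₀ hε] at hK; linarith
  calc weight g k ^ 2 ≤ 1 * weight g n ^ 2 := by rw [one_mul]; exact h2
    _ ≤ ε * (K / 2) * weight g n ^ 2 := by gcongr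
    _ = ε * (K / 2 * weight g n ^ 2) := by ring
    _ ≤ _ := by gcongr

end Weights

/-! ### The learning model -/

section Model

variable {Ω 𝒳 𝒴 : Type*} [MeasurableSpace 𝒳] [MeasurableSpace 𝒴]

/-- The first `n` samples `z_1, …, z_n`. -/
def past (z : ℕ → Ω → 𝒳 × 𝒴) (n : ℕ) (ω : Ω) : Fin n → 𝒳 × 𝒴 := fun s => z (s + 1) ω

/-- The loss, on a further sample, of the function learned from `n` given samples. -/
def lossFn (ℓ : 𝒴 → 𝒴 → ℝ) (A : (n : ℕ) → (Fin n → 𝒳 × 𝒴) → 𝒳 → 𝒴) (n : ℕ)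
    (p : (Fin n → 𝒳 × 𝒴) × (𝒳 × 𝒴)) : ℝ :=
  ℓ (A n p.1 p.2.1) p.2.2

/-- The centred update at time `n + 2` with weight `g`, as a function of the first `n + 1` samples
and of the new one. -/
noncomputable def updateFn (ℓ : 𝒴 → 𝒴 → ℝ) (A : (n : ℕ) → (Fin n → 𝒳 × 𝒴) → 𝒳 → 𝒴)
    (D : Measure (𝒳 × 𝒴)) (g : ℝ) (n : ℕ) (p : (Fin (n + 1) → 𝒳 × 𝒴) × (𝒳 × 𝒴)) : ℝ :=
  (lossFn ℓ A (n + 1) p - (1 - g) * lossFn ℓ A n (Fin.init p.1, p.2))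
    - (∫ w, lossFn ℓ A (n + 1) (p.1, w) ∂D - (1 - g) * ∫ w, lossFn ℓ A n (Fin.init p.1, w) ∂D)

/-- The second moment of the centred update over the new sample. -/
noncomputable def updateVar (ℓ : 𝒴 → 𝒴 → ℝ) (A : (n : ℕ) → (Fin n → 𝒳 × 𝒴) → 𝒳 → 𝒴)
    (D : Measure (𝒳 × 𝒴)) (g : ℝ) (n : ℕ) (y : Fin (n + 1) → 𝒳 × 𝒴) : ℝ :=
  ∫ w, updateFn ℓ A D g n (y, w) ^ 2 ∂D

variable {D : Measure (𝒳 × 𝒴)} {z : ℕ → Ω → 𝒳 × 𝒴}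
  {A : (n : ℕ) → (Fin n → 𝒳 × 𝒴) → 𝒳 → 𝒴} {ℓ : 𝒴 → 𝒴 → ℝ}

lemma measurable_sampleSigma (z : ℕ → Ω → 𝒳 × 𝒴) {s n : ℕ} (h1 : 1 ≤ s) (hn : s ≤ n) :
    Measurable[sampleSigma z n] (z s) := by
  rw [measurable_iff_comap_le]
  exact le_iSup₂_of_le s (Finset.mem_Icc.2 ⟨h1, hn⟩) le_rfl

lemma sampleSigma_mono (z : ℕ → Ω → 𝒳 × 𝒴) : Monotone (sampleSigma z) := fun m n hmn =>
  iSup₂_le fun s hs => by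
    rw [← measurable_iff_comap_le]
    exact measurable_sampleSigma z (Finset.mem_Icc.1 hs).1 ((Finset.mem_Icc.1 hs).2.trans hmn)

lemma measurable_past_sampleSigma (z : ℕ → Ω → 𝒳 × 𝒴) {m n : ℕ} (hmn : m ≤ n) :
    Measurable[sampleSigma z n] (past z m) :=
  @measurable_pi_lambda _ _ _ (sampleSigma z n) _ _ fun s =>
    measurable_sampleSigma z (by omega) (by have := s.2; omega)

lemma sampleSigma_eq_comap (z : ℕ → Ω → 𝒳 × 𝒴) (n : ℕ) :
    sampleSigma z n = MeasurableSpace.comap (past z n) inferInstance := by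
  refine le_antisymm (iSup₂_le fun s hs => ?_)
    (measurable_iff_comap_le.1 (measurable_past_sampleSigma z le_rfl))
  obtain ⟨h1, h2⟩ := Finset.mem_Icc.1 hs
  have e : z s = (fun y : Fin n → 𝒳 × 𝒴 => y ⟨s - 1, by omega⟩) ∘ past z n := by
    ext1 ω
    simp [past, Nat.sub_add_cancel h1]
  rw [e, ← MeasurableSpace.comap_comp]
  exact MeasurableSpace.comap_mono (measurable_iff_comap_le.1 (measurable_pi_apply _))

lemma centered_add_two (γ : ℕ → ℝ) (n : ℕ) (ω : Ω) :
    centered ℓ A z D γ (n + 2) ω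
      = (1 - γ (n + 2)) * centered ℓ A z D γ (n + 1) ω + increment ℓ A z D γ (n + 2) ω := by
  simp only [centered, increment, estimator, Nat.add_one_sub_one]
  ring_nf

variable [MeasurableSpace Ω] {μ : Measure Ω}

/-- The standing assumptions on the data: i.i.d. samples with law `D`, and a measurable learning
algorithm and loss. -/
structure IsModel (μ : Measure Ω) (D : Measure (𝒳 × 𝒴)) (z : ℕ → Ω → 𝒳 × 𝒴)
    (A : (n : ℕ) → (Fin n → 𝒳 × 𝒴) → 𝒳 → 𝒴) (ℓ : 𝒴 → 𝒴 → ℝ) : Prop where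
  measurable_sample : ∀ t, 1 ≤ t → Measurable (z t)
  law : ∀ t, 1 ≤ t → μ.map (z t) = D
  indep : iIndepFun (fun t => z (t + 1)) μ
  measurable_algorithm : ∀ n, Measurable (fun p : (Fin n → 𝒳 × 𝒴) × 𝒳 => A n p.1 p.2)
  measurable_loss : Measurable (fun p : 𝒴 × 𝒴 => ℓ p.1 p.2)

namespace IsModel

lemma sampleSigma_le (h : IsModel μ D z A ℓ) (n : ℕ) : sampleSigma z n ≤ ‹MeasurableSpace Ω› :=
  iSup₂_le fun s hs => (h.measurable_sample s (Finset.mem_Icc.1 hs).1).comap_le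

lemma measurable_past (h : IsModel μ D z A ℓ) (n : ℕ) : Measurable (past z n) :=
  (measurable_past_sampleSigma z le_rfl).mono (h.sampleSigma_le n) le_rfl

lemma measurable_lossFn (h : IsModel μ D z A ℓ) (n : ℕ) : Measurable (lossFn ℓ A n) :=
  h.measurable_loss.comp (((h.measurable_algorithm n).comp
    (measurable_fst.prodMk (measurable_fst.comp measurable_snd))).prodMk
      (measurable_snd.comp measurable_snd))

lemma measurable_integral_lossFn [SFinite D] (h : IsModel μ D z A ℓ) (n : ℕ) :
    Measurable fun y => ∫ w, lossFn ℓ A n (y, w) ∂D :=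
  ((h.measurable_lossFn n).stronglyMeasurable.integral_prod_right').measurable

lemma measurable_updateFn [SFinite D] (h : IsModel μ D z A ℓ) (g : ℝ) (n : ℕ) :
    Measurable (updateFn ℓ A D g n) := by
  have hi : Measurable (fun y : Fin (n + 1) → 𝒳 × 𝒴 => (Fin.init y : Fin n → 𝒳 × 𝒴)) :=
    measurable_pi_lambda _ fun s => measurable_pi_apply _
  exact ((h.measurable_lossFn _).sub (((h.measurable_lossFn n).comp
    ((hi.comp measurable_fst).prodMk measurable_snd)).const_mul _)).sub
      (((h.measurable_integral_lossFn (n + 1)).comp measurable_fst).sub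
        (((h.measurable_integral_lossFn n).comp (hi.comp measurable_fst)).const_mul _))

lemma measurable_updateVar [SFinite D] (h : IsModel μ D z A ℓ) (g : ℝ) (n : ℕ) :
    Measurable (updateVar ℓ A D g n) :=
  (((h.measurable_updateFn g n).pow_const 2).stronglyMeasurable.integral_prod_right').measurable

lemma indepFun_past (h : IsModel μ D z A ℓ) (n : ℕ) : IndepFun (past z n) (z (n + 1)) μ := by
  have h1 := h.indep.indepFun_finset (Finset.range n) {n} (by simp)
    (fun i => h.measurable_sample _ (by omega))
  have hφ : Measurable fun (y : Finset.range n → 𝒳 × 𝒴) (s : Fin n) =>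
      y ⟨s, Finset.mem_range.2 s.2⟩ := measurable_pi_lambda _ fun s => measurable_pi_apply _
  have hψ : Measurable fun y : ({n} : Finset ℕ) → 𝒳 × 𝒴 => y ⟨n, Finset.mem_singleton_self n⟩ :=
    measurable_pi_apply _
  exact h1.comp hφ hψ

/-- Conditioning on `F_n` a function of the past and of the new sample amounts to averaging over a
fresh sample. -/
lemma condExp_past [IsProbabilityMeasure μ] (h : IsModel μ D z A ℓ) (n : ℕ)
    {f : (Fin n → 𝒳 × 𝒴) × (𝒳 × 𝒴) → ℝ} (hf : Measurable f)
    (hi : Integrable (fun ω => f (past z n ω, z (n + 1) ω)) μ) :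
    μ[fun ω => f (past z n ω, z (n + 1) ω) | sampleSigma z n]
      =ᵐ[μ] fun ω => ∫ w, f (past z n ω, w) ∂D := by
  rw [sampleSigma_eq_comap]
  have := condExp_comap_of_indepFun (h.measurable_past n) (h.measurable_sample (n + 1) (by omega))
    (h.indepFun_past n) hf hi
  rwa [h.law (n + 1) (by omega)] at this

lemma measurable_lossAt_sample (h : IsModel μ D z A ℓ) {t s n : ℕ} (ht : t ≤ n + 1) (hs : 1 ≤ s)
    (hsn : s ≤ n) : Measurable[sampleSigma z n] fun ω => lossAt ℓ A z t ω (z s ω) :=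
  (h.measurable_lossFn (t - 1)).comp
    ((measurable_past_sampleSigma z (by omega)).prodMk (measurable_sampleSigma z hs hsn))

lemma measurable_expectedLoss [SFinite D] (h : IsModel μ D z A ℓ) {t n : ℕ} (ht : t ≤ n + 1) :
    Measurable[sampleSigma z n] (expectedLoss ℓ A z D t) :=
  (h.measurable_integral_lossFn (t - 1)).comp (measurable_past_sampleSigma z (by omega))

lemma measurable_estimator (h : IsModel μ D z A ℓ) (γ : ℕ → ℝ) :
    ∀ t, Measurable[sampleSigma z t] (estimator ℓ A z γ t)
  | 0 => measurable_const
  | 1 => h.measurable_lossAt_sample (by omega) le_rfl le_rfl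
  | t + 2 => (h.measurable_lossAt_sample (by omega) (by omega) le_rfl).add
      ((((h.measurable_estimator γ (t + 1)).mono (sampleSigma_mono z (by omega)) le_rfl).sub
        (h.measurable_lossAt_sample (by omega) (by omega) le_rfl)).const_mul _)

lemma measurable_centered [SFinite D] (h : IsModel μ D z A ℓ) (γ : ℕ → ℝ) (t : ℕ) :
    Measurable[sampleSigma z t] (centered ℓ A z D γ t) :=
  (h.measurable_estimator γ t).sub (h.measurable_expectedLoss (by omega))

end IsModel

lemma condVarSum_succ (γ : ℕ → ℝ) (n : ℕ) (ω : Ω) :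
    condVarSum μ ℓ A z D γ (n + 1) ω = (1 - γ (n + 1)) ^ 2 * condVarSum μ ℓ A z D γ n ω
      + (Var[centered ℓ A z D γ (n + 1); μ | sampleSigma z n]) ω := by
  unfold condVarSum
  rw [Finset.sum_Icc_succ_top (by omega), Finset.mul_sum]
  congr 1
  · refine Finset.sum_congr rfl fun i hi => ?_
    rw [Finset.prod_Icc_succ_top (by have := (Finset.mem_Icc.1 hi).2; omega)]
    ring
  · simp

section Fresh

variable [IsProbabilityMeasure D]

lemma integral_updateFn {g : ℝ} {n : ℕ} {y : Fin (n + 1) → 𝒳 × 𝒴}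
    (h1 : MemLp (fun w => lossFn ℓ A (n + 1) (y, w)) 2 D)
    (h0 : MemLp (fun w => lossFn ℓ A n (Fin.init y, w)) 2 D) :
    ∫ w, updateFn ℓ A D g n (y, w) ∂D = 0 := by
  have i1 := h1.integrable (by norm_num)
  have i0 := (h0.integrable (by norm_num)).const_mul (1 - g)
  simp only [updateFn]
  rw [integral_sub (by exact i1.sub i0) (integrable_const _), integral_sub i1 i0,
    integral_const_mul]
  simp

/-- The second moment of the update is the variance of `(ℓ_t - ℓ_{t-1}) + γ_t ℓ_{t-1}`, so its root
differs from `γ_t` times the standard deviation of `ℓ_{t-1}` by that of `ℓ_t - ℓ_{t-1}` at most. -/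
lemma abs_sqrt_updateVar_sub_le {g : ℝ} (hg : 0 ≤ g) {n : ℕ} {y : Fin (n + 1) → 𝒳 × 𝒴}
    (h1 : MemLp (fun w => lossFn ℓ A (n + 1) (y, w)) 2 D)
    (h0 : MemLp (fun w => lossFn ℓ A n (Fin.init y, w)) 2 D) :
    |√(updateVar ℓ A D g n y) - g * √(Var[fun w => lossFn ℓ A n (Fin.init y, w); D])|
      ≤ √(Var[fun w => lossFn ℓ A (n + 1) (y, w) - lossFn ℓ A n (Fin.init y, w); D]) := by
  have hd := h1.sub h0
  have hgl := h0.const_mul g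
  have key := abs_sqrt_variance_add_sub_le hd hgl
  rw [variance_const_mul, Real.sqrt_mul (sq_nonneg g), Real.sqrt_sq hg] at key
  have e : updateVar ℓ A D g n y
      = Var[fun w =>
        ((fun w => lossFn ℓ A (n + 1) (y, w)) - fun w => lossFn ℓ A n (Fin.init y, w)) w
        + g * lossFn ℓ A n (Fin.init y, w); D] := by
    rw [variance_eq_integral (by exact (hd.add hgl).aestronglyMeasurable.aemeasurable), updateVar]
    refine integral_congr_ae (ae_of_all _ fun w => ?_)
    have i1 := h1.integrable (by norm_num)
    have i0 := h0.integrable (by norm_num)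
    simp only [updateFn, Pi.sub_apply]
    rw [integral_add (by exact i1.sub i0) (i0.const_mul g), integral_sub i1 i0,
      integral_const_mul]
    ring
  rw [e]
  exact key

end Fresh
end Model

/-! ### Standardized increments -/

section Standardized

variable {Ω 𝒳 𝒴 : Type*} [MeasurableSpace 𝒳] [MeasurableSpace 𝒴]
  {D : Measure (𝒳 × 𝒴)} {z : ℕ → Ω → 𝒳 × 𝒴}
  {A : (n : ℕ) → (Fin n → 𝒳 × 𝒴) → 𝒳 → 𝒴} {ℓ : 𝒴 → 𝒴 → ℝ}

/-- The conditional standard deviation of the increment at time `n + 2`. -/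
noncomputable def condSd (ℓ : 𝒴 → 𝒴 → ℝ) (A : (n : ℕ) → (Fin n → 𝒳 × 𝒴) → 𝒳 → 𝒴)
    (z : ℕ → Ω → 𝒳 × 𝒴) (D : Measure (𝒳 × 𝒴)) (γ : ℕ → ℝ) (n : ℕ) (ω : Ω) : ℝ :=
  √(updateVar ℓ A D (γ (n + 2)) n (past z (n + 1) ω))

/-- The increment at time `n + 2`, divided by its conditional standard deviation. -/
noncomputable def standardized (ℓ : 𝒴 → 𝒴 → ℝ) (A : (n : ℕ) → (Fin n → 𝒳 × 𝒴) → 𝒳 → 𝒴)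
    (z : ℕ → Ω → 𝒳 × 𝒴) (D : Measure (𝒳 × 𝒴)) (γ : ℕ → ℝ) (n : ℕ) (ω : Ω) : ℝ :=
  increment ℓ A z D γ (n + 2) ω / condSd ℓ A z D γ n ω

lemma condSd_sq (γ : ℕ → ℝ) (n : ℕ) (ω : Ω) :
    condSd ℓ A z D γ n ω ^ 2 = updateVar ℓ A D (γ (n + 2)) n (past z (n + 1) ω) :=
  Real.sq_sqrt (integral_nonneg fun _ => sq_nonneg _)

variable [MeasurableSpace Ω] {μ : Measure Ω}

namespace IsModel

variable [IsProbabilityMeasure D]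

lemma measurable_condSd (h : IsModel μ D z A ℓ) (γ : ℕ → ℝ) (n : ℕ) :
    Measurable[sampleSigma z (n + 1)] (condSd ℓ A z D γ n) :=
  ((h.measurable_updateVar (γ (n + 2)) n).sqrt).comp (measurable_past_sampleSigma z le_rfl)

lemma measurable_increment (h : IsModel μ D z A ℓ) (γ : ℕ → ℝ) (n : ℕ) :
    Measurable[sampleSigma z (n + 2)] (increment ℓ A z D γ (n + 2)) :=
  (h.measurable_updateFn (γ (n + 2)) n).comp
    ((measurable_past_sampleSigma z (by omega)).prodMk
      (measurable_sampleSigma z (by omega) le_rfl))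

lemma measurable_standardized (h : IsModel μ D z A ℓ) (γ : ℕ → ℝ) (n : ℕ) :
    Measurable[sampleSigma z (n + 2)] (standardized ℓ A z D γ n) :=
  (h.measurable_increment γ n).div
    ((h.measurable_condSd γ n).mono (sampleSigma_mono z (by omega)) le_rfl)

lemma memLp_standardized (h : IsModel μ D z A ℓ) {γ : ℕ → ℝ} {n : ℕ} {c C : ℝ} (hc : 0 < c)
    (hγ : 0 < γ (n + 2))
    (hL : MemLp (increment ℓ A z D γ (n + 2)) 4 μ)
    (hs : ∀ᵐ ω ∂μ, condSd ℓ A z D γ n ω / γ (n + 2) ∈ Set.Icc c C) :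
    MemLp (standardized ℓ A z D γ n) 4 μ := by
  refine hL.of_le_mul (c := 1 / (c * γ (n + 2)))
    ((h.measurable_standardized γ n).mono (h.sampleSigma_le _) le_rfl).aestronglyMeasurable ?_
  filter_upwards [hs] with ω hω
  have h1 := (le_div_iff₀ hγ).1 hω.1
  have h2 : 0 < c * γ (n + 2) := by positivity
  rw [standardized, norm_div, Real.norm_of_nonneg (h2.trans_le h1).le, one_div,
    div_eq_inv_mul]
  gcongr

variable [IsProbabilityMeasure μ]

lemma condExp_increment (h : IsModel μ D z A ℓ) {γ : ℕ → ℝ} {n : ℕ}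
    (hL : MemLp (increment ℓ A z D γ (n + 2)) 4 μ)
    (h0 : ∀ᵐ ω ∂μ, ∫ w, updateFn ℓ A D (γ (n + 2)) n (past z (n + 1) ω, w) ∂D = 0) :
    μ[increment ℓ A z D γ (n + 2) | sampleSigma z (n + 1)] =ᵐ[μ] fun _ => 0 := by
  have := h.condExp_past (n + 1) (h.measurable_updateFn (γ (n + 2)) n)
    (hL.integrable (by norm_num))
  exact this.trans h0

lemma condExp_increment_sq (h : IsModel μ D z A ℓ) {γ : ℕ → ℝ} {n : ℕ}
    (hL : MemLp (increment ℓ A z D γ (n + 2)) 4 μ) :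
    μ[fun ω => increment ℓ A z D γ (n + 2) ω ^ 2 | sampleSigma z (n + 1)]
      =ᵐ[μ] fun ω => condSd ℓ A z D γ n ω ^ 2 := by
  have := h.condExp_past (n + 1) ((h.measurable_updateFn (γ (n + 2)) n).pow_const 2)
    (hL.mono_exponent (show (2 : ENNReal) ≤ 4 by norm_num)).integrable_sq
  exact this.trans (ae_of_all _ fun ω => (condSd_sq γ n ω).symm)

lemma condVar_centered (h : IsModel μ D z A ℓ) {γ : ℕ → ℝ} {n : ℕ}
    (hL : MemLp (increment ℓ A z D γ (n + 2)) 4 μ)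
    (h0 : ∀ᵐ ω ∂μ, ∫ w, updateFn ℓ A D (γ (n + 2)) n (past z (n + 1) ω, w) ∂D = 0)
    (hM : Integrable (centered ℓ A z D γ (n + 1)) μ) :
    Var[centered ℓ A z D γ (n + 2); μ | sampleSigma z (n + 1)]
      =ᵐ[μ] fun ω => condSd ℓ A z D γ n ω ^ 2 := by
  have hle := h.sampleSigma_le (n + 1)
  have e : centered ℓ A z D γ (n + 2)
      = (fun ω => (1 - γ (n + 2)) * centered ℓ A z D γ (n + 1) ω)
        + increment ℓ A z D γ (n + 2) := by
    ext ω
    exact centered_add_two γ n ω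
  have h1 : μ[centered ℓ A z D γ (n + 2) | sampleSigma z (n + 1)]
      =ᵐ[μ] fun ω => (1 - γ (n + 2)) * centered ℓ A z D γ (n + 1) ω := by
    rw [e]
    have h2 := condExp_add (hM.const_mul (1 - γ (n + 2))) (hL.integrable (by norm_num))
      (sampleSigma z (n + 1))
    rw [condExp_of_stronglyMeasurable hle
      ((h.measurable_centered γ (n + 1)).const_mul _).stronglyMeasurable (hM.const_mul _)] at h2
    filter_upwards [h2, h.condExp_increment hL h0] with ω h3 h4
    rw [h3, Pi.add_apply, h4, add_zero]
  refine EventuallyEq.trans (condExp_congr_ae ?_) (h.condExp_increment_sq hL)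
  filter_upwards [h1] with ω h2
  simp only [Pi.pow_apply, Pi.sub_apply, h2]
  rw [centered_add_two]
  ring

section Bounds

variable {γ : ℕ → ℝ} {n : ℕ} {c C : ℝ}

lemma condExp_standardized (h : IsModel μ D z A ℓ) (hc : 0 < c) (hγ : 0 < γ (n + 2))
    (hL : MemLp (increment ℓ A z D γ (n + 2)) 4 μ)
    (hs : ∀ᵐ ω ∂μ, condSd ℓ A z D γ n ω / γ (n + 2) ∈ Set.Icc c C)
    (h0 : ∀ᵐ ω ∂μ, ∫ w, updateFn ℓ A D (γ (n + 2)) n (past z (n + 1) ω, w) ∂D = 0) :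
    μ[standardized ℓ A z D γ n | sampleSigma z (n + 1)] =ᵐ[μ] fun _ => 0 := by
  have := h.condExp_past (n + 1)
    (f := fun p => updateFn ℓ A D (γ (n + 2)) n p / √(updateVar ℓ A D (γ (n + 2)) n p.1))
    ((h.measurable_updateFn _ n).div ((h.measurable_updateVar _ n).sqrt.comp measurable_fst))
    ((h.memLp_standardized hc hγ hL hs).integrable (by norm_num))
  refine this.trans ?_
  filter_upwards [h0] with ω hω
  rw [integral_div, hω, zero_div]

lemma condExp_standardized_sq (h : IsModel μ D z A ℓ) (hc : 0 < c) (hγ : 0 < γ (n + 2))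
    (hL : MemLp (increment ℓ A z D γ (n + 2)) 4 μ)
    (hs : ∀ᵐ ω ∂μ, condSd ℓ A z D γ n ω / γ (n + 2) ∈ Set.Icc c C) :
    μ[fun ω => standardized ℓ A z D γ n ω ^ 2 | sampleSigma z (n + 1)] =ᵐ[μ] fun _ => 1 := by
  have := h.condExp_past (n + 1)
    (f := fun p => (updateFn ℓ A D (γ (n + 2)) n p / √(updateVar ℓ A D (γ (n + 2)) n p.1)) ^ 2)
    (((h.measurable_updateFn _ n).div
      ((h.measurable_updateVar _ n).sqrt.comp measurable_fst)).pow_const 2)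
    ((h.memLp_standardized hc hγ hL hs).mono_exponent
      (show (2 : ENNReal) ≤ 4 by norm_num)).integrable_sq
  refine this.trans ?_
  filter_upwards [hs] with ω hω
  have h1 := (le_div_iff₀ hγ).1 hω.1
  have h2 : 0 < condSd ℓ A z D γ n ω := (mul_pos hc hγ).trans_le h1
  simp_rw [div_pow]
  rw [integral_div]
  change updateVar ℓ A D (γ (n + 2)) n (past z (n + 1) ω) / condSd ℓ A z D γ n ω ^ 2 = 1
  rw [← condSd_sq]
  exact div_self (by positivity)

/-- Bounded kurtosis of the increments bounds the fourth moments of the standardized increments. -/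
lemma integral_standardized_pow_four_le (h : IsModel μ D z A ℓ) (hc : 0 < c)
    (hγ : 0 < γ (n + 2)) (hL : MemLp (increment ℓ A z D γ (n + 2)) 4 μ)
    (hs : ∀ᵐ ω ∂μ, condSd ℓ A z D γ n ω / γ (n + 2) ∈ Set.Icc c C)
    (h0 : ∀ᵐ ω ∂μ, ∫ w, updateFn ℓ A D (γ (n + 2)) n (past z (n + 1) ω, w) ∂D = 0)
    {κ : ℝ} (hκ : kurtosis (increment ℓ A z D γ (n + 2)) μ ≤ κ) :
    ∫ ω, standardized ℓ A z D γ n ω ^ 4 ∂μ ≤ κ * C ^ 4 / c ^ 4 := by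
  set X := increment ℓ A z D γ (n + 2) with hX
  have hle := h.sampleSigma_le (n + 1)
  have hc' : 0 < c * γ (n + 2) := mul_pos hc hγ
  have hX1 : ∫ ω, X ω ∂μ = 0 := by
    rw [← integral_condExp hle, integral_congr_ae (h.condExp_increment hL h0)]
    simp
  have hb : ∀ᵐ ω ∂μ, condSd ℓ A z D γ n ω ∈ Set.Icc (c * γ (n + 2)) (C * γ (n + 2)) := by
    filter_upwards [hs] with ω hω
    exact ⟨(le_div_iff₀ hγ).1 hω.1, (div_le_iff₀ hγ).1 hω.2⟩
  have hvar : Var[X; μ] = ∫ ω, condSd ℓ A z D γ n ω ^ 2 ∂μ := by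
    rw [variance_eq_integral hL.aestronglyMeasurable.aemeasurable, hX1,
      ← integral_congr_ae (h.condExp_increment_sq hL), integral_condExp hle]
    simp [hX]
  have hsdi : Integrable (fun ω => condSd ℓ A z D γ n ω ^ 2) μ :=
    integrable_condExp.congr (h.condExp_increment_sq hL)
  have hlo : (c * γ (n + 2)) ^ 2 ≤ Var[X; μ] := by
    rw [hvar]
    have : ∫ _, (c * γ (n + 2)) ^ 2 ∂μ ≤ ∫ ω, condSd ℓ A z D γ n ω ^ 2 ∂μ := by
      refine integral_mono_ae (integrable_const _) hsdi ?_
      filter_upwards [hb] with ω hω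
      exact pow_le_pow_left₀ hc'.le hω.1 2
    simpa using this
  have hhi : Var[X; μ] ≤ (C * γ (n + 2)) ^ 2 := by
    rw [hvar]
    have : ∫ ω, condSd ℓ A z D γ n ω ^ 2 ∂μ ≤ ∫ _, (C * γ (n + 2)) ^ 2 ∂μ := by
      refine integral_mono_ae hsdi (integrable_const _) ?_
      filter_upwards [hb] with ω hω
      exact pow_le_pow_left₀ (hc'.le.trans hω.1) hω.2 2
    simpa using this
  have hvpos : 0 < Var[X; μ] := lt_of_lt_of_le (by positivity) hlo
  have hmom : centralMoment X 4 μ = ∫ ω, X ω ^ 4 ∂μ := by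
    simp [centralMoment, hX1]
  have hX4 : 0 ≤ ∫ ω, X ω ^ 4 ∂μ := integral_nonneg fun ω => by positivity
  rw [kurtosis, hmom] at hκ
  have hκ0 : 0 ≤ κ := (by positivity : 0 ≤ (∫ ω, X ω ^ 4 ∂μ) / Var[X; μ] ^ 2).trans hκ
  have hX4le : ∫ ω, X ω ^ 4 ∂μ ≤ κ * (C * γ (n + 2)) ^ 4 := by
    rw [div_le_iff₀ (by positivity)] at hκ
    refine hκ.trans (mul_le_mul_of_nonneg_left ?_ hκ0)
    calc Var[X; μ] ^ 2 ≤ ((C * γ (n + 2)) ^ 2) ^ 2 := pow_le_pow_left₀ hvpos.le hhi 2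
      _ = _ := by ring
  calc ∫ ω, standardized ℓ A z D γ n ω ^ 4 ∂μ
      ≤ ∫ ω, X ω ^ 4 / (c * γ (n + 2)) ^ 4 ∂μ := by
        refine integral_mono_ae (h.memLp_standardized hc hγ hL hs).integrable_pow_four
          (hL.integrable_pow_four.div_const _) ?_
        filter_upwards [hb] with ω hω
        have := hω.1
        simp only [standardized, div_pow]
        gcongr
    _ ≤ κ * (C * γ (n + 2)) ^ 4 / (c * γ (n + 2)) ^ 4 := by
        rw [integral_div]
        gcongr
    _ = _ := by field_simp

end Bounds
end IsModel
end Standardized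

/-! ### Unrolling the recursion -/

section Unrolling

variable {Ω 𝒳 𝒴 : Type*} [MeasurableSpace 𝒳] [MeasurableSpace 𝒴]
  {D : Measure (𝒳 × 𝒴)} {z : ℕ → Ω → 𝒳 × 𝒴}
  {A : (n : ℕ) → (Fin n → 𝒳 × 𝒴) → 𝒳 → 𝒴} {ℓ : 𝒴 → 𝒴 → ℝ}

/-- Unrolling the recursion for the centred estimator from time `m + 1` on. -/
lemma centered_eq_prod_mul {γ : ℕ → ℝ} {m : ℕ} (hγ : ∀ k, 0 < γ (m + k + 2))
    (hγ1 : ∀ k, γ (m + k + 2) < 1) {ω : Ω} (hω : ∀ k, condSd ℓ A z D γ (m + k) ω ≠ 0) (n : ℕ) :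
    centered ℓ A z D γ (m + n + 1) ω
      = (∏ j ∈ Finset.range n, (1 - γ (m + j + 2))) * (centered ℓ A z D γ (m + 1) ω
        + ∑ k ∈ Finset.range n, weight (fun j => γ (m + j + 2)) k
          * (condSd ℓ A z D γ (m + k) ω / γ (m + k + 2) * standardized ℓ A z D γ (m + k) ω)) := by
  induction n with
  | zero => simp
  | succ n ih =>
    have e := centered_add_two (ℓ := ℓ) (A := A) (z := z) (D := D) γ (m + n) ω
    change centered ℓ A z D γ (m + n + 2) ω = _
    rw [e, ih, Finset.sum_range_succ, Finset.prod_range_succ, standardized, weight,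
      Finset.prod_range_succ]
    have h1 := (hγ n).ne'
    have h2 := hω n
    have h3 : (∏ j ∈ Finset.range n, (1 - γ (m + j + 2))) ≠ 0 :=
      (Finset.prod_pos fun j _ => sub_pos.2 (hγ1 j)).ne'
    have h4 : 1 - γ (m + n + 2) ≠ 0 := (sub_pos.2 (hγ1 n)).ne'
    field_simp
    ring

variable [MeasurableSpace Ω] {μ : Measure Ω}

/-- Unrolling the recursion for the sum of conditional variances from time `m + 1` on. -/
lemma condVarSum_eq_prod_sq_mul {γ : ℕ → ℝ} {m : ℕ} (hγ : ∀ k, 0 < γ (m + k + 2))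
    (hγ1 : ∀ k, γ (m + k + 2) < 1) {ω : Ω}
    (hω : ∀ k, (Var[centered ℓ A z D γ (m + k + 2); μ | sampleSigma z (m + k + 1)]) ω
      = condSd ℓ A z D γ (m + k) ω ^ 2) (n : ℕ) :
    condVarSum μ ℓ A z D γ (m + n + 1) ω
      = (∏ j ∈ Finset.range n, (1 - γ (m + j + 2))) ^ 2 * (condVarSum μ ℓ A z D γ (m + 1) ω
        + ∑ k ∈ Finset.range n, weight (fun j => γ (m + j + 2)) k ^ 2
          * (condSd ℓ A z D γ (m + k) ω / γ (m + k + 2)) ^ 2) := by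
  induction n with
  | zero => simp
  | succ n ih =>
    have e := condVarSum_succ (μ := μ) (ℓ := ℓ) (A := A) (z := z) (D := D) γ (m + n + 1) ω
    change condVarSum μ ℓ A z D γ (m + n + 1 + 1) ω = _
    rw [e, ih, hω n, Finset.sum_range_succ, Finset.prod_range_succ, weight,
      Finset.prod_range_succ]
    have h1 := (hγ n).ne'
    have h3 : (∏ j ∈ Finset.range n, (1 - γ (m + j + 2))) ≠ 0 :=
      (Finset.prod_pos fun j _ => sub_pos.2 (hγ1 j)).ne'
    have h4 : 1 - γ (m + n + 2) ≠ 0 := (sub_pos.2 (hγ1 n)).ne'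
    field_simp
    ring

namespace IsModel

lemma measurable_condVarSum (h : IsModel μ D z A ℓ) (γ : ℕ → ℝ) (t : ℕ) :
    Measurable (condVarSum μ ℓ A z D γ t) :=
  Finset.measurable_fun_sum _ fun _ _ =>
    ((stronglyMeasurable_condVar.mono (h.sampleSigma_le _)).measurable).const_mul _

variable [IsProbabilityMeasure D]

lemma measurable_lossVar (h : IsModel μ D z A ℓ) (t : ℕ) : Measurable (lossVar ℓ A z D t) := by
  have h1 : Measurable fun p : (Fin (t - 1) → 𝒳 × 𝒴) × (𝒳 × 𝒴) =>
      ‖lossFn ℓ A (t - 1) p - ∫ w, lossFn ℓ A (t - 1) (p.1, w) ∂D‖ₑ ^ 2 :=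
    (((h.measurable_lossFn _).sub
      ((h.measurable_integral_lossFn _).comp measurable_fst)).enorm).pow_const 2
  exact (h1.lintegral_prod_right'.ennreal_toReal).comp (h.measurable_past (t - 1))

/-- The estimator at time one involves no learned data, so that it is integrable as soon as the
initial loss is. -/
lemma integrable_centered_one [IsProbabilityMeasure μ] (h : IsModel μ D z A ℓ) (γ : ℕ → ℝ)
    (hL : ∀ᵐ ω ∂μ, MemLp (fun w => lossFn ℓ A 0 (past z 0 ω, w)) 2 D) :
    Integrable (centered ℓ A z D γ 1) μ := by
  obtain ⟨ω₀, h0⟩ := hL.exists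
  have hi : Integrable (fun w => lossFn ℓ A 0 (past z 0 ω₀, w)) (μ.map (z 1)) := by
    rw [h.law 1 le_rfl]
    exact h0.integrable (by norm_num)
  refine ((hi.comp_measurable (h.measurable_sample 1 le_rfl)).sub
    (integrable_const (∫ w, lossFn ℓ A 0 (past z 0 ω₀, w) ∂D))).congr (ae_of_all _ fun ω => ?_)
  rw [Subsingleton.elim (past z 0 ω₀) (past z 0 ω)]
  rfl

lemma integrable_centered [IsProbabilityMeasure μ] (h : IsModel μ D z A ℓ) {γ : ℕ → ℝ}
    (hL : ∀ᵐ ω ∂μ, MemLp (fun w => lossFn ℓ A 0 (past z 0 ω, w)) 2 D)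
    (hξ : ∀ n, MemLp (increment ℓ A z D γ (n + 2)) 4 μ) (n : ℕ) :
    Integrable (centered ℓ A z D γ (n + 1)) μ := by
  induction n with
  | zero => exact h.integrable_centered_one γ hL
  | succ n ih =>
    refine ((ih.const_mul (1 - γ (n + 2))).add ((hξ n).integrable (by norm_num))).congr
      (ae_of_all _ fun ω => ?_)
    exact (centered_add_two γ n ω).symm

end IsModel
end Unrolling

end Oeuvre

/-! ### The central limit theorem for the estimator -/

open Oeuvre in
theorem mainTheorem4 {Ω 𝒳 𝒴 : Type*} [MeasurableSpace Ω] [MeasurableSpace 𝒳] [MeasurableSpace 𝒴]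
    (μ : Measure Ω) [IsProbabilityMeasure μ]
    (D : Measure (𝒳 × 𝒴)) [IsProbabilityMeasure D]
    -- the samples z_1, z_2, … are i.i.d. with law D (z 0 is not used)
    (z : ℕ → Ω → 𝒳 × 𝒴)
    (hz_meas : ∀ t, 1 ≤ t → Measurable (z t))
    (hz_law : ∀ t, 1 ≤ t → μ.map (z t) = D)
    (hz_indep : iIndepFun (fun t => z (t + 1)) μ)
    -- the learning algorithm and the loss function
    (A : (n : ℕ) → (Fin n → 𝒳 × 𝒴) → 𝒳 → 𝒴)
    (hA_meas : ∀ n, Measurable (fun p : (Fin n → 𝒳 × 𝒴) × 𝒳 => A n p.1 p.2))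
    (ℓ : 𝒴 → 𝒴 → ℝ)
    (hℓ_meas : Measurable (fun p : 𝒴 × 𝒴 => ℓ p.1 p.2))
    (hℓ_nonneg : ∀ y y', 0 ≤ ℓ y y')
    -- the weights
    (γ : ℕ → ℝ) (hγ_mem : ∀ t, 2 ≤ t → γ t ∈ Set.Icc (0 : ℝ) 1)
    -- the deterministic bounds on the change of the loss
    (σ : ℕ → ℝ) (hσ_nonneg : ∀ t, 2 ≤ t → 0 ≤ σ t)
    (hσ : ∀ t, 2 ≤ t → ∀ᵐ ω ∂μ, Oeuvre.lossDiffVar ℓ A z D t ω ≤ σ t ^ 2)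
    -- (i) the conditional variances of the losses lie in [ν², b²]
    (ν b : ℝ) (hν : 0 < ν) (hb : 0 < b)
    (hvar : ∀ t, 1 ≤ t → ∀ᵐ ω ∂μ, Oeuvre.lossVar ℓ A z D t ω ∈ Set.Icc (ν ^ 2) (b ^ 2))
    -- (ii) they converge in probability to v*
    (vstar : Ω → ℝ) (hvstar_meas : Measurable vstar)
    (hvstar_mem : ∀ᵐ ω ∂μ, vstar ω ∈ Set.Icc (ν ^ 2) (b ^ 2))
    (hvar_tendsto : TendstoInMeasure μ (Oeuvre.lossVar ℓ A z D) atTop vstar)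
    -- (iii) the increments have bounded kurtosis
    (κ : ℝ)
    (hkurt : ∀ t, 2 ≤ t → MemLp (Oeuvre.increment ℓ A z D γ t) 4 μ ∧
      Oeuvre.kurtosis (Oeuvre.increment ℓ A z D γ t) μ ≤ κ)
    -- (iv) the rate conditions on the weights, with γ_t = ω(σ_t)
    (hγ_zero : Tendsto γ atTop (𝓝 0))
    (hγ_ratio : Tendsto (fun t => γ (t + 1) / γ t) atTop (𝓝 1))
    (hγ_rate : ∀ᶠ t in atTop, 0 < γ t ∧ 1 / γ (t + 1) - 1 / γ t ≤ 1)
    (hγ_omega : σ =o[atTop] γ) :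
    TendstoInDistribution
      (fun t ω => Oeuvre.centered ℓ A z D γ t ω / √(Oeuvre.condVarSum μ ℓ A z D γ t ω))
      atTop (id : ℝ → ℝ) (fun _ => μ) (gaussianReal 0 1) := by
  have h : IsModel μ D z A ℓ := ⟨hz_meas, hz_law, hz_indep, hA_meas, hℓ_meas⟩
  have hL : ∀ n, ∀ᵐ ω ∂μ, MemLp (fun w => lossFn ℓ A n (past z n ω, w)) 2 D := fun n => by
    filter_upwards [hvar (n + 1) (by omega)] with ω hω
    -- `Var` is zero by convention off `L²`, so a positive variance forces square integrability
    refine memLp_two_of_variance_pos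
      ((h.measurable_lossFn n).comp measurable_prodMk_left).aestronglyMeasurable ?_
    exact (by positivity : 0 < ν ^ 2).trans_le hω.1
  have hξ : ∀ n, MemLp (increment ℓ A z D γ (n + 2)) 4 μ := fun n => (hkurt _ (by omega)).1
  have h0 : ∀ n, ∀ᵐ ω ∂μ, ∫ w, updateFn ℓ A D (γ (n + 2)) n (past z (n + 1) ω, w) ∂D = 0 :=
    fun n => by
      filter_upwards [hL n, hL (n + 1)] with ω h1 h2
      exact integral_updateFn h2 h1
  have hM := h.integrable_centered (hL 0) hξ
  have hsd : ∀ n, ∀ᵐ ω ∂μ,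
      |condSd ℓ A z D γ n ω - γ (n + 2) * √(lossVar ℓ A z D (n + 1) ω)| ≤ σ (n + 2) := fun n => by
    filter_upwards [hL n, hL (n + 1), hσ (n + 2) (by omega)] with ω h1 h2 h3
    refine (abs_sqrt_updateVar_sub_le (hγ_mem (n + 2) (by omega)).1 h2 h1).trans ?_
    exact Real.sqrt_le_iff.2 ⟨hσ_nonneg _ (by omega), h3⟩
  have hV : ∀ t, 1 ≤ t → ∀ᵐ ω ∂μ, √(lossVar ℓ A z D t ω) ∈ Set.Icc ν b := fun t ht => by
    filter_upwards [hvar t ht] with ω hω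
    exact ⟨Real.le_sqrt_of_sq_le hω.1, Real.sqrt_le_iff.2 ⟨hb.le, hω.2⟩⟩
  -- from time `m + 2` on the weights are regular and the drift of the loss is negligible
  have hlt : Tendsto (fun t => σ t / γ t) atTop (𝓝 0) := hγ_omega.tendsto_div_nhds_zero
  obtain ⟨m, hm⟩ := eventually_atTop.1 (hγ_rate.and ((hγ_zero.eventually_lt_const one_pos).and
    (hlt.eventually_le_const (half_pos hν))))
  set g : ℕ → ℝ := fun k => γ (m + k + 2) with hg
  have hg0 : ∀ k, 0 < γ (m + k + 2) := fun k => (hm _ (by omega)).1.1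
  have hg1 : ∀ k, γ (m + k + 2) < 1 := fun k => (hm _ (by omega)).2.1
  have hgrate : ∀ k, 1 / g (k + 1) - 1 / g k ≤ 1 := fun k => (hm (m + k + 2) (by omega)).1.2
  have hshift : Tendsto (fun k => m + k + 2) atTop atTop :=
    tendsto_atTop_mono (fun k => by simp only [id_eq]; omega) tendsto_id
  have hgzero : Tendsto g atTop (𝓝 0) := hγ_zero.comp hshift
  have hgratio : Tendsto (fun k => g (k + 1) / g k) atTop (𝓝 1) := hγ_ratio.comp hshift
  -- the random part of the conditional standard deviations
  set ρ : ℕ → Ω → ℝ := fun k ω => condSd ℓ A z D γ (m + k) ω / γ (m + k + 2) with hρ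
  have hρd : ∀ k, ∀ᵐ ω ∂μ, |ρ k ω - √(lossVar ℓ A z D (m + k + 1) ω)|
      ≤ σ (m + k + 2) / γ (m + k + 2) := fun k => by
    filter_upwards [hsd (m + k)] with ω hω
    have h1 := hg0 k
    rw [le_div_iff₀ h1]
    refine le_trans (le_of_eq ?_) hω
    rw [← abs_of_pos h1, ← abs_mul, abs_of_pos h1, hρ]
    congr 1
    field_simp
  have hρb : ∀ k, ∀ᵐ ω ∂μ, ρ k ω ∈ Set.Icc (ν / 2) (b + ν / 2) := fun k => by
    filter_upwards [hρd k, hV (m + k + 1) (by omega)] with ω h1 h2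
    have h3 := abs_le.1 (h1.trans (hm _ (by omega)).2.2)
    constructor <;> linarith [h2.1, h2.2, h3.1, h3.2]
  have hρm : ∀ k, Measurable (ρ k) := fun k =>
    ((h.measurable_condSd γ (m + k)).mono (h.sampleSigma_le _) le_rfl).div_const _
  have hρlim : TendstoInMeasure μ ρ atTop (fun ω => √(vstar ω)) := by
    have h1 : TendstoInMeasure μ (fun k => lossVar ℓ A z D (m + k + 1)) atTop vstar :=
      hvar_tendsto.comp (tendsto_atTop_mono (fun k => by simp only [id_eq]; omega) tendsto_id)
    have h2 : TendstoInMeasure μ (fun k ω => ρ k ω - √(lossVar ℓ A z D (m + k + 1) ω)) atTop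
        (fun _ => 0) := by
      refine tendstoInMeasure_of_tendsto_ae
        (fun k => ((hρm k).sub (h.measurable_lossVar _).sqrt).aestronglyMeasurable) ?_
      filter_upwards [ae_all_iff.2 hρd] with ω hω
      exact squeeze_zero_norm hω (hlt.comp hshift)
    have h3 := tendstoInMeasure_comp₂ h1 h2 (f := fun p => √p.1 + p.2)
      (ae_of_all _ fun ω => by fun_prop) (fun k => by simpa using (hρm k).aestronglyMeasurable)
    simpa using h3
  have hvs : ∀ᵐ ω ∂μ, √(vstar ω) ∈ Set.Icc (ν / 2) (b + ν / 2) := by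
    filter_upwards [hvstar_mem] with ω hω
    have h1 : ν ≤ √(vstar ω) := Real.le_sqrt_of_sq_le hω.1
    have h2 : √(vstar ω) ≤ b := Real.sqrt_le_iff.2 ⟨hb.le, hω.2⟩
    constructor <;> linarith
  -- the standardized increments
  let ℱ : Filtration ℕ ‹MeasurableSpace Ω› :=
    { seq := fun k => sampleSigma z (m + k + 1)
      mono' := fun i j hij => sampleSigma_mono z (by omega)
      le' := fun k => h.sampleSigma_le _ }
  have hν2 : 0 < ν / 2 := half_pos hν
  have hη : IsNormalizedMartingaleDiff ℱ (fun k => standardized ℓ A z D γ (m + k)) μ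
      (κ * (b + ν / 2) ^ 4 / (ν / 2) ^ 4) :=
    { stronglyMeasurable := fun k => (h.measurable_standardized γ (m + k)).stronglyMeasurable
      memLp := fun k => h.memLp_standardized hν2 (hg0 k) (hξ _) (hρb k)
      condExp_eq := fun k => h.condExp_standardized hν2 (hg0 k) (hξ _) (hρb k) (h0 _)
      condExp_sq := fun k => h.condExp_standardized_sq hν2 (hg0 k) (hξ _) (hρb k)
      moment_four_le := fun k => h.integral_standardized_pow_four_le hν2 (hg0 k) (hξ _) (hρb k)
        (h0 _) (hkurt _ (by omega)).2 }
  have hMm : ∀ t, Measurable (centered ℓ A z D γ t) := fun t =>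
    (h.measurable_centered γ t).mono (h.sampleSigma_le t) le_rfl
  have key := hη.tendstoInDistribution_selfNormalized
    (tendsto_sum_weight_sq hg0 hg1 hgrate)
    (fun ε hε => eventually_weight_sq_le hg0 hg1 hgrate hgzero hgratio hε)
    hν2 (ρ := ρ) (fun k => ((h.measurable_condSd γ (m + k)).div_const _).stronglyMeasurable)
    hvstar_meas.sqrt.aemeasurable hρb hvs hρlim (hMm (m + 1)).aemeasurable
    (h.measurable_condVarSum γ (m + 1)).aemeasurable
  refine tendstoInDistribution_of_shift
    (fun t => ((hMm t).div (h.measurable_condVarSum γ t).sqrt).aemeasurable) (m + 1)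
    (key.congr (fun n => ?_) (ae_eq_refl _))
  filter_upwards [ae_all_iff.2 hρb,
    ae_all_iff.2 fun k => h.condVar_centered (hξ (m + k)) (h0 (m + k)) (hM (m + k))] with ω h1 h2
  have h3 : ∀ k, condSd ℓ A z D γ (m + k) ω ≠ 0 := fun k hk => by
    have := (h1 k).1
    simp only [hρ, hk, zero_div] at this
    linarith
  have hQ : 0 < ∏ j ∈ Finset.range n, (1 - γ (m + j + 2)) :=
    Finset.prod_pos fun j _ => sub_pos.2 (hg1 j)
  have e : n + (m + 1) = m + n + 1 := by omega
  rw [e, centered_eq_prod_mul hg0 hg1 h3, condVarSum_eq_prod_sq_mul hg0 hg1 h2,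
    Real.sqrt_mul (sq_nonneg _), Real.sqrt_sq hQ.le, mul_div_mul_left _ _ hQ.ne']
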